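/- Let $n\ge 3$ and, for $\lambda\in\mathbb R$, let $\hat h_\lambda=-\Delta-\lambda\,\mathbf 1_{\{|x|<1\}}$ be the Schrödinger operator on $L^2(\mathbb R^n)$ with domain $H^2(\mathbb R^n)$. Denote by $\sigma_{\mathrm{disc}}$ the discrete spectrum, i.e. the set of isolated points of the spectrum that are eigenvalues of finite multiplicity. Then there exists $\lambda_c>0$ such that $\sigma_{\mathrm{disc}}(\hat h_\lambda)=\emptyset$ for every $\lambda<\lambda_c$ and $\sigma_{\mathrm{disc}}(\hat h_\lambda)\neq\emptyset$ for every $\lambda>\lambda_c$. Moreover, $\hat h_{\lambda_c}$ has a virtual level at zero: $\hat h_{\lambda_c}\ge 0$, and $\inf\sigma\bigl(-\Delta-(1+\varepsilon)\lambda_c\mathbf 1_{\{|x|<1\}}\bigr)<0$ for every $\varepsilon>0$. -/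

import Mathlib

noncomputable section

namespace Schroedinger

open MeasureTheory TemperedDistribution
open scoped SchwartzMap Laplacian

/-! ### Spectral notions for unbounded operators on a complex Hilbert space -/

section Spectral

variable {H : Type*} [NormedAddCommGroup H] [InnerProductSpace ℂ H]

/-- The resolvent set of an unbounded operator `T`: all `z` such that `T - z`, as a map from the
domain of `T` to the whole space, has a bounded everywhere defined two-sided inverse `R`. -/
def resolventSet (T : H →ₗ.[ℂ] H) : Set ℂ :=
  {z | ∃ R : H →L[ℂ] H,
    (∀ f : H, ∃ h : R f ∈ T.domain, T ⟨R f, h⟩ - z • R f = f) ∧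
    (∀ u : T.domain, R (T u - z • (u : H)) = u)}

/-- The spectrum of an unbounded operator. -/
def spectrum (T : H →ₗ.[ℂ] H) : Set ℂ := (resolventSet T)ᶜ

/-- The eigenspace `{u ∈ dom T | T u = z u}`. -/
def eigenspace (T : H →ₗ.[ℂ] H) (z : ℂ) : Submodule ℂ H where
  carrier := {u | ∃ h : u ∈ T.domain, T ⟨u, h⟩ = z • u}
  zero_mem' := ⟨T.domain.zero_mem, by
    rw [smul_zero]; exact T.map_zero⟩
  add_mem' := by
    rintro u v ⟨hu, hu'⟩ ⟨hv, hv'⟩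
    refine ⟨T.domain.add_mem hu hv, ?_⟩
    rw [smul_add, ← hu', ← hv', ← T.map_add]; rfl
  smul_mem' := by
    rintro c u ⟨hu, hu'⟩
    refine ⟨T.domain.smul_mem c hu, ?_⟩
    rw [smul_comm, ← hu', ← T.map_smul]; rfl

/-- The discrete spectrum: isolated points of the spectrum that are eigenvalues of finite
multiplicity. -/
def discreteSpectrum (T : H →ₗ.[ℂ] H) : Set ℂ :=
  {z | z ∈ spectrum T ∧ (∃ r > 0, ∀ w ∈ spectrum T, dist w z < r → w = z) ∧
    eigenspace T z ≠ ⊥ ∧ FiniteDimensional ℂ (eigenspace T z)}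

/-- The infimum of the (real) spectrum, as an extended real number. -/
def infSpectrum (T : H →ₗ.[ℂ] H) : EReal :=
  sInf {e : EReal | ∃ t : ℝ, (t : ℂ) ∈ spectrum T ∧ e = (t : EReal)}

/-- `T ≥ 0`, i.e. `⟨u, T u⟩ ≥ 0` for all `u` in the domain of `T`. -/
def IsNonneg (T : H →ₗ.[ℂ] H) : Prop :=
  ∀ u : T.domain, 0 ≤ (inner ℂ (u : H) (T u)).re

end Spectral

/-! ### Schrödinger operators on `L²(ℝⁿ)` -/

/-- The complex Hilbert space `L²(ℝⁿ)`. -/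
abbrev L2 (n : ℕ) : Type := Lp ℂ 2 (volume : Measure (EuclideanSpace ℝ (Fin n)))

/-- The Sobolev space `H²(ℝⁿ)`, as a subspace of `L²(ℝⁿ)`. -/
def sobolevH2 (n : ℕ) : Submodule ℂ (L2 n) where
  carrier := {u | MemSobolev 2 2 (u : 𝓢'(EuclideanSpace ℝ (Fin n), ℂ))}
  zero_mem' := by
    have h : MemSobolev 2 2 (Lp.toTemperedDistributionCLM ℂ volume 2 (0 : L2 n)) := by
      rw [map_zero]; exact memSobolev_fun_zero _ _ _ _
    exact h
  add_mem' := by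
    intro u v hu hv
    have h : MemSobolev 2 2 (Lp.toTemperedDistributionCLM ℂ volume 2 (u + v)) := by
      rw [map_add]; exact MemSobolev.add hu hv
    exact h
  smul_mem' := by
    intro c u hu
    have h : MemSobolev 2 2 (Lp.toTemperedDistributionCLM ℂ volume 2 (c • u)) := by
      rw [map_smul]; exact MemSobolev.smul c hu
    exact h

/-- The distributional Laplacian of an `H²` function is an `L²` function. -/
theorem exists_laplacian {n : ℕ} (u : sobolevH2 n) :
    ∃ w : L2 n, Δ ((u : L2 n) : 𝓢'(EuclideanSpace ℝ (Fin n), ℂ)) =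
      (w : 𝓢'(EuclideanSpace ℝ (Fin n), ℂ)) := by
  have h := MemSobolev.laplacian (u.2 : MemSobolev 2 2 _)
  rw [sub_self] at h
  exact memSobolev_zero_iff.mp h

theorem toTemperedDistribution_inj {n : ℕ} {u v : L2 n}
    (h : (u : 𝓢'(EuclideanSpace ℝ (Fin n), ℂ)) = (v : 𝓢'(EuclideanSpace ℝ (Fin n), ℂ))) :
    u = v :=
  LinearMap.ker_eq_bot.mp
    (Lp.ker_toTemperedDistributionCLM_eq_bot (F := ℂ)
      (μ := (volume : Measure (EuclideanSpace ℝ (Fin n)))) (p := 2)) h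

/-- The `L²` function representing the distributional Laplacian of an `H²` function. -/
def laplacianL2 {n : ℕ} (u : sobolevH2 n) : L2 n := (exists_laplacian u).choose

theorem laplacianL2_spec {n : ℕ} (u : sobolevH2 n) :
    Δ ((u : L2 n) : 𝓢'(EuclideanSpace ℝ (Fin n), ℂ)) =
      (laplacianL2 u : 𝓢'(EuclideanSpace ℝ (Fin n), ℂ)) :=
  (exists_laplacian u).choose_spec

/-- The operator `-Δ` on `L²(ℝⁿ)` with domain `H²(ℝⁿ)`. -/
def negLaplacian (n : ℕ) : L2 n →ₗ.[ℂ] L2 n where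
  domain := sobolevH2 n
  toFun :=
    { toFun := fun u => -laplacianL2 u
      map_add' := by
        intro u v
        rw [← neg_add, neg_inj]
        apply toTemperedDistribution_inj
        rw [← laplacianL2_spec]
        simp only [← Lp.toTemperedDistributionCLM_apply, ← laplacianCLM_apply,
          Submodule.coe_add, map_add]
        simp only [Lp.toTemperedDistributionCLM_apply, laplacianCLM_apply, laplacianL2_spec]
      map_smul' := by
        intro c u
        rw [RingHom.id_apply, smul_neg, neg_inj]
        apply toTemperedDistribution_inj
        rw [← laplacianL2_spec]
        simp only [← Lp.toTemperedDistributionCLM_apply, ← laplacianCLM_apply,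
          Submodule.coe_smul, map_smul]
        simp only [Lp.toTemperedDistributionCLM_apply, laplacianCLM_apply, laplacianL2_spec] }

theorem mul_add_ae {n : ℕ} (V : EuclideanSpace ℝ (Fin n) → ℝ) (u v : L2 n) :
    (fun x => (V x : ℂ) * (u + v : L2 n) x) =ᵐ[volume]
      (fun x => (V x : ℂ) * u x) + fun x => (V x : ℂ) * v x := by
  filter_upwards [Lp.coeFn_add u v] with x hx
  rw [hx, Pi.add_apply, Pi.add_apply, mul_add]

theorem mul_smul_ae {n : ℕ} (V : EuclideanSpace ℝ (Fin n) → ℝ) (c : ℂ) (u : L2 n) :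
    (fun x => (V x : ℂ) * (c • u : L2 n) x) =ᵐ[volume] c • fun x => (V x : ℂ) * u x := by
  filter_upwards [Lp.coeFn_smul c u] with x hx
  rw [hx, Pi.smul_apply, Pi.smul_apply, smul_eq_mul, smul_eq_mul, mul_left_comm]

/-- The maximal domain `{u ∈ L² | V u ∈ L²}` of multiplication by the real potential `V`. -/
def mulDomain {n : ℕ} (V : EuclideanSpace ℝ (Fin n) → ℝ) : Submodule ℂ (L2 n) where
  carrier := {u | MemLp (fun x => (V x : ℂ) * u x) 2 volume}
  zero_mem' := by
    refine MemLp.ae_eq ?_ (MemLp.zero' (ε := ℂ))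
    filter_upwards [Lp.coeFn_zero ℂ 2 (volume : Measure (EuclideanSpace ℝ (Fin n)))] with x hx
    rw [hx, Pi.zero_apply, mul_zero]
  add_mem' := fun {u v} hu hv => (MemLp.add hu hv).ae_eq (mul_add_ae V u v).symm
  smul_mem' := fun c u hu => (MemLp.const_smul hu c).ae_eq (mul_smul_ae V c u).symm

theorem memLp_of_mem_mulDomain {n : ℕ} {V : EuclideanSpace ℝ (Fin n) → ℝ} {u : L2 n}
    (hu : u ∈ mulDomain V) : MemLp (fun x => (V x : ℂ) * u x) 2 volume := hu

/-- Multiplication by the real potential `V` on its maximal domain. -/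
def mulOperator {n : ℕ} (V : EuclideanSpace ℝ (Fin n) → ℝ) : L2 n →ₗ.[ℂ] L2 n where
  domain := mulDomain V
  toFun :=
    { toFun := fun u => MemLp.toLp (fun x => (V x : ℂ) * (u : L2 n) x) (memLp_of_mem_mulDomain u.2)
      map_add' := by
        intro u v
        rw [← MemLp.toLp_add, MemLp.toLp_eq_toLp_iff]
        exact mul_add_ae V u v
      map_smul' := by
        intro c u
        rw [RingHom.id_apply, ← MemLp.toLp_const_smul, MemLp.toLp_eq_toLp_iff]
        exact mul_smul_ae V c u }

/-- The Schrödinger operator `-Δ + V` on `L²(ℝⁿ)`, the operator sum, defined on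
`H²(ℝⁿ) ∩ {u | V u ∈ L²}`. For bounded measurable `V` this domain is `H²(ℝⁿ)`. -/
def schrodinger {n : ℕ} (V : EuclideanSpace ℝ (Fin n) → ℝ) : L2 n →ₗ.[ℂ] L2 n :=
  negLaplacian n + mulOperator V

/-- `-Δ + V` has a virtual level at zero: `-Δ + V ≥ 0`, and `inf σ(-Δ + (1 + ε) V) < 0` for every
`ε > 0`. -/
def HasVirtualLevelAtZero {n : ℕ} (V : EuclideanSpace ℝ (Fin n) → ℝ) : Prop :=
  IsNonneg (schrodinger V) ∧
    ∀ ε : ℝ, 0 < ε → infSpectrum (schrodinger (fun x => (1 + ε) * V x)) < 0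

/-- The potential `-c · 1_{|x| < 1}` on `ℝⁿ`. -/
def well (n : ℕ) (c : ℝ) (x : EuclideanSpace ℝ (Fin n)) : ℝ :=
  -c * (Metric.ball (0 : EuclideanSpace ℝ (Fin n)) 1).indicator (fun _ => (1 : ℝ)) x

end Schroedinger

end

/-! The argument is the Birman–Schwinger principle for `T = -Δ`, with resolvent `G s = (T + s)⁻¹`,
and the projection `P` given by multiplication by the indicator of the ball. Put `K s = P * G s *
P`, a compact positive operator, and let `N` be the supremum of `‖K s‖` over `s > 0`. The critical
coupling is `1 / N`.

If `l ≤ 1 / N`, the inequality `‖P u‖² ≤ ‖K s‖ (⟨u, T u⟩ + s ‖u‖²)` of `norm_sq_le` yields `T - l P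
≥ 0` as `s → 0`. Eigenvalues are then nonnegative, while all of `[0, ∞)` is spectrum by approximate
eigenfunctions (`exists_approx_eigenfunction`), so no eigenvalue is isolated. If `l > 1 / N`,
continuity and decay of `‖K s‖` give some `s` with `‖K s‖ = 1 / l`. This norm is an eigenvalue of `K
s`, hence `-s` is an eigenvalue of `T - l P` (`eigenspace_ne_bot`). Compactness of `G s * P` makes
it isolated and of finite multiplicity. The virtual level follows, since `(1 + ε) / N > 1 / N`.

The dimension enters through `N < ∞` (`exists_norm_ballProj_mul_le`): the Fourier transform of a
function supported in the ball is bounded, and `|ξ|⁻²` is integrable near the origin when `n ≥ 3`.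
-/

namespace Schroedinger

open Filter Topology
open scoped InnerProductSpace

/-! ### Birman–Schwinger theory for an abstract nonnegative operator `T` and a projection `P` -/

section Abstract

variable {H : Type*} [NormedAddCommGroup H] [InnerProductSpace ℂ H]

/-- The operator `T - l P`, where `P` is bounded, with the domain of `T`. -/
def subBounded (T : H →ₗ.[ℂ] H) (P : H →L[ℂ] H) (l : ℝ) : H →ₗ.[ℂ] H where
  domain := T.domain
  toFun := T.toFun - (l : ℂ) • ((P : H →ₗ[ℂ] H) ∘ₗ T.domain.subtype)

theorem subBounded_apply (T : H →ₗ.[ℂ] H) (P : H →L[ℂ] H) (l : ℝ)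
    (u : (subBounded T P l).domain) :
    subBounded T P l u = T ⟨u, u.2⟩ - (l : ℂ) • P u := rfl

/-- `G s = (T + s)⁻¹` for all `s > 0`, and these operators are positive with `‖G s‖ ≤ 1 / s`. -/
structure IsResolventFamily (T : H →ₗ.[ℂ] H) (G : ℝ → H →L[ℂ] H) : Prop where
  mem_domain : ∀ s, 0 < s → ∀ f, G s f ∈ T.domain
  right_inv : ∀ s (hs : 0 < s) f, T ⟨G s f, mem_domain s hs f⟩ + (s : ℂ) • G s f = f
  left_inv : ∀ s, 0 < s → ∀ u : T.domain, G s (T u + (s : ℂ) • (u : H)) = u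
  nonneg : ∀ s, 0 < s → 0 ≤ G s
  norm_le : ∀ s, 0 < s → ‖G s‖ ≤ 1 / s

namespace IsResolventFamily

variable {T : H →ₗ.[ℂ] H} {G : ℝ → H →L[ℂ] H} {P : H →L[ℂ] H}

theorem inner_left (hG : IsResolventFamily T G) {s : ℝ} (hs : 0 < s) (f g : H) :
    ⟪G s f, g⟫_ℂ = ⟪f, G s g⟫_ℂ := by
  have h := (ContinuousLinearMap.nonneg_iff_isPositive _).1 (hG.nonneg s hs)
  exact h.isSymmetric f g

/-- The symmetry of `G 1`, tested on `(T + 1) u` and `(T + 1) v`, passes to its inverse. -/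
theorem inner_apply_left (hG : IsResolventFamily T G) (u v : T.domain) :
    ⟪T u, (v : H)⟫_ℂ = ⟪(u : H), T v⟫_ℂ := by
  have h := hG.inner_left one_pos (T u + ((1 : ℝ) : ℂ) • (u : H)) (T v + ((1 : ℝ) : ℂ) • (v : H))
  rw [hG.left_inv 1 one_pos, hG.left_inv 1 one_pos] at h
  simp only [inner_add_left, inner_add_right, Complex.ofReal_one, one_smul] at h
  exact (add_right_cancel h).symm

theorem re_inner_eq (hG : IsResolventFamily T G) {s : ℝ} (hs : 0 < s) (u : T.domain) :
    (⟪T u + (s : ℂ) • (u : H), G s (T u + (s : ℂ) • (u : H))⟫_ℂ).re =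
      (⟪(u : H), T u⟫_ℂ).re + s * ‖(u : H)‖ ^ 2 := by
  rw [hG.left_inv s hs, inner_add_left, inner_smul_left, hG.inner_apply_left, Complex.conj_ofReal,
    Complex.add_re, Complex.re_ofReal_mul]
  congr 2
  exact inner_self_eq_norm_sq (𝕜 := ℂ) (u : H)

theorem re_inner_add_nonneg (hG : IsResolventFamily T G) {s : ℝ} (hs : 0 < s) (u : T.domain) :
    0 ≤ (⟪(u : H), T u⟫_ℂ).re + s * ‖(u : H)‖ ^ 2 := by
  rw [← hG.re_inner_eq hs]
  exact ((ContinuousLinearMap.nonneg_iff_isPositive _).1 (hG.nonneg s hs)).re_inner_nonneg_right _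

/-- The first resolvent identity; it provides the norm continuity of `G`. -/
theorem sub_eq (hG : IsResolventFamily T G) {s t : ℝ} (hs : 0 < s) (ht : 0 < t) :
    G s - G t = ((t - s : ℝ) : ℂ) • (G s * G t) := by
  ext f
  have h := hG.left_inv s hs ⟨G t f, hG.mem_domain t ht f⟩
  have h2 := hG.right_inv t ht f
  have h3 : T ⟨G t f, hG.mem_domain t ht f⟩ + (s : ℂ) • G t f
      = f - ((t - s : ℝ) : ℂ) • G t f := by
    rw [← sub_eq_iff_eq_add.2 h2.symm]
    push_cast
    module
  rw [h3, map_sub, map_smul] at h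
  change G s f - G t f = ((t - s : ℝ) : ℂ) • G s (G t f)
  rw [sub_eq_iff_eq_add.1 h]
  abel

/-- Applying `G s` turns the eigenvalue equation near `-s` into a fixed-point equation for bounded
operators, in which `G s * P` will be compact and `ζ` small. -/
theorem eq_of_mem_eigenspace (hG : IsResolventFamily T G) {s : ℝ} (hs : 0 < s) {l : ℝ} {ζ : ℂ}
    {u : H} (hu : u ∈ eigenspace (subBounded T P l) (-s + ζ)) :
    u = ζ • G s u + (l : ℂ) • G s (P u) := by
  obtain ⟨hd, hu⟩ := hu
  have hd : u ∈ T.domain := hd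
  have h1 := hG.left_inv s hs ⟨u, hd⟩
  change T ⟨u, hd⟩ - (l : ℂ) • P u = _ at hu
  rw [sub_eq_iff_eq_add.1 hu] at h1
  have h2 : (-(s : ℂ) + ζ) • u + (l : ℂ) • P u + (s : ℂ) • u = ζ • u + (l : ℂ) • P u := by module
  simp only [h2, map_add, map_smul] at h1
  exact h1.symm

theorem mem_eigenspace_of_eq (hG : IsResolventFamily T G) {s : ℝ} (hs : 0 < s) {l : ℝ} {ζ : ℂ}
    {u : H} (hu : u = ζ • G s u + (l : ℂ) • G s (P u)) :
    u ∈ eigenspace (subBounded T P l) (-s + ζ) := by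
  have hu' : u = G s (ζ • u + (l : ℂ) • P u) := by
    rw [map_add, map_smul, map_smul]; exact hu
  have hd : u ∈ T.domain := by rw [hu']; exact hG.mem_domain s hs _
  refine ⟨hd, ?_⟩
  have h1 := hG.right_inv s hs (ζ • u + (l : ℂ) • P u)
  have h2 : (⟨G s (ζ • u + (l : ℂ) • P u), hG.mem_domain s hs _⟩ : T.domain) = ⟨u, hd⟩ :=
    Subtype.ext hu'.symm
  rw [h2, ← hu'] at h1
  change T ⟨u, hd⟩ - (l : ℂ) • P u = _
  rw [eq_sub_iff_add_eq.2 h1]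
  module

/-- Approximate eigenvectors of `T` on which `P` is small put `E` into the spectrum. -/
theorem _root_.Schroedinger.mem_spectrum_of_approx {T : H →ₗ.[ℂ] H} {P : H →L[ℂ] H} {E : ℂ}
    (hW : ∀ δ : ℝ, 0 < δ → ∃ u : T.domain, (u : H) ≠ 0 ∧ ‖T u - E • (u : H)‖ ≤ δ * ‖(u : H)‖ ∧
      ‖P u‖ ≤ δ * ‖(u : H)‖) (l : ℝ) : E ∈ spectrum (subBounded T P l) := by
  rintro ⟨R, -, hR⟩
  -- Chosen so that `‖R‖ δ (1 + |l|) < 1`, which contradicts `u = R (T - l P - E) u` for `u ≠ 0`.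
  set δ : ℝ := 1 / (2 * (‖R‖ + 1) * (1 + |l|)) with hδ
  obtain ⟨u, hu0, h1, h2⟩ := hW δ (by positivity)
  have hpos : 0 < ‖(u : H)‖ := norm_pos_iff.2 hu0
  have h3 : subBounded T P l ⟨u, u.2⟩ - E • (u : H) = (T u - E • (u : H)) - (l : ℂ) • P u := by
    rw [subBounded_apply]; abel
  have h4 : ‖subBounded T P l ⟨u, u.2⟩ - E • (u : H)‖ ≤ δ * (1 + |l|) * ‖(u : H)‖ := by
    rw [h3]
    refine (norm_sub_le _ _).trans ?_
    rw [norm_smul, Complex.norm_real, Real.norm_eq_abs]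
    nlinarith [mul_le_mul_of_nonneg_left h2 (abs_nonneg l)]
  have h5 : ‖(u : H)‖ ≤ ‖R‖ * (δ * (1 + |l|) * ‖(u : H)‖) := by
    conv_lhs => rw [← hR ⟨u, u.2⟩]
    exact (R.le_opNorm _).trans (by gcongr)
  have h6 : δ * (1 + |l|) * (2 * (‖R‖ + 1)) = 1 := by
    have : (1 + |l|) ≠ 0 := by positivity
    have : (‖R‖ + 1) ≠ 0 := by positivity
    rw [hδ]; field_simp
  have h7 : ‖R‖ * (δ * (1 + |l|)) < 1 := by
    have : 0 < δ * (1 + |l|) := by positivity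
    nlinarith [norm_nonneg R]
  nlinarith

theorem inner_subBounded_left [CompleteSpace H] (hG : IsResolventFamily T G)
    (hP : IsSelfAdjoint P) (l : ℝ) (u v : (subBounded T P l).domain) :
    ⟪subBounded T P l u, (v : H)⟫_ℂ = ⟪(u : H), subBounded T P l v⟫_ℂ := by
  have hsym : ⟪P u, (v : H)⟫_ℂ = ⟪(u : H), P v⟫_ℂ := hP.isSymmetric u v
  have hT : ⟪T ⟨u, u.2⟩, (v : H)⟫_ℂ = ⟪(u : H), T ⟨v, v.2⟩⟫_ℂ :=
    hG.inner_apply_left ⟨u, u.2⟩ ⟨v, v.2⟩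
  rw [subBounded_apply, subBounded_apply, inner_sub_left, inner_sub_right, inner_smul_left,
    inner_smul_right, hT, hsym, Complex.conj_ofReal]

/-! ### The Birman–Schwinger operators `P * G s * P` -/

variable [CompleteSpace H]

/-- With `S` the positive square root of `G s`, the C*-identity gives `‖P * G s * P‖ = ‖P * S‖²`.
Moreover `P G s w = (P S)(S w)` and `‖S w‖² = ⟨w, G s w⟩`. -/
theorem norm_sq_apply_le (hG : IsResolventFamily T G) (hP : IsSelfAdjoint P) {s : ℝ} (hs : 0 < s)
    (w : H) : ‖P (G s w)‖ ^ 2 ≤ ‖P * G s * P‖ * (⟪w, G s w⟫_ℂ).re := by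
  set S := CFC.sqrt (G s) with hS
  have hSS : S * S = G s := CFC.sqrt_mul_sqrt_self _ (hG.nonneg s hs)
  have hSa : IsSelfAdjoint S := IsSelfAdjoint.of_nonneg (CFC.sqrt_nonneg _)
  have hsym : ∀ f g, ⟪S f, g⟫_ℂ = ⟪f, S g⟫_ℂ := hSa.isSymmetric
  have h1 : ‖P * G s * P‖ = ‖P * S‖ * ‖P * S‖ := by
    rw [← CStarRing.norm_self_mul_star, star_mul, hP.star_eq, hSa.star_eq, ← hSS]
    simp only [mul_assoc]
  have h2 : ⟪w, G s w⟫_ℂ = ⟪S w, S w⟫_ℂ := by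
    rw [← hSS, hsym]; rfl
  have h3 : P (G s w) = (P * S) (S w) := by
    rw [← hSS]; rfl
  have h4 : (⟪S w, S w⟫_ℂ).re = ‖S w‖ ^ 2 := inner_self_eq_norm_sq (𝕜 := ℂ) (S w)
  rw [h1, h2, h3, h4, ← sq, ← mul_pow]
  exact pow_le_pow_left₀ (norm_nonneg _) ((P * S).le_opNorm _) 2

theorem norm_sq_le (hG : IsResolventFamily T G) (hP : IsSelfAdjoint P) {s : ℝ} (hs : 0 < s)
    (u : T.domain) : ‖P u‖ ^ 2 ≤
      ‖P * G s * P‖ * ((⟪(u : H), T u⟫_ℂ).re + s * ‖(u : H)‖ ^ 2) := by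
  have h := hG.norm_sq_apply_le hP hs (T u + (s : ℂ) • (u : H))
  rwa [hG.re_inner_eq hs, hG.left_inv s hs] at h

/-- This makes the supremum `N` positive. If the product vanished, `norm_sq_apply_le` would give `P
* G s = 0`, taking adjoints `G s * P = 0`, and injectivity of `G s` would force `P = 0`. -/
theorem mul_mul_ne_zero (hG : IsResolventFamily T G) (hP : IsSelfAdjoint P) (hP0 : P ≠ 0) {s : ℝ}
    (hs : 0 < s) : P * G s * P ≠ 0 := by
  intro h0
  apply hP0
  ext w
  have h := fun x => hG.norm_sq_apply_le hP hs x
  rw [h0, norm_zero] at h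
  have h' : P * G s = 0 := by
    ext x
    have := h x
    rw [zero_mul] at this
    simpa using this
  have h2 : G s * P = 0 := by
    have := congrArg star h'
    rwa [star_mul, hP.star_eq, (IsSelfAdjoint.of_nonneg (hG.nonneg s hs)).star_eq, star_zero]
      at this
  have h3 : G s (P w) = 0 := by
    have := congrArg (fun A : H →L[ℂ] H => A w) h2
    simpa using this
  have h4 := hG.right_inv s hs (P w)
  have h5 : T ⟨G s (P w), hG.mem_domain s hs (P w)⟩ = 0 := by
    rw [show (⟨G s (P w), hG.mem_domain s hs (P w)⟩ : T.domain) = 0 from Subtype.ext h3]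
    exact T.map_zero
  rw [h5, h3] at h4
  simpa using h4.symm

theorem continuousOn_norm (hG : IsResolventFamily T G) :
    ContinuousOn (fun s => ‖P * G s * P‖) (Set.Ioi 0) := by
  have hGc : ContinuousOn G (Set.Ioi 0) := by
    intro t ht
    have ht : 0 < t := ht
    rw [ContinuousWithinAt, tendsto_iff_norm_sub_tendsto_zero]
    have hlim : Tendsto (fun s : ℝ => |t - s| * (1 / s * (1 / t))) (𝓝[Set.Ioi 0] t) (𝓝 0) := by
      have : ContinuousAt (fun s : ℝ => |t - s| * (1 / s * (1 / t))) t := by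
        have := ht.ne'
        fun_prop (disch := assumption)
      have h2 := this.tendsto.mono_left (nhdsWithin_le_nhds (s := Set.Ioi 0))
      simpa using h2
    refine squeeze_zero' (Eventually.of_forall fun _ => norm_nonneg _) ?_ hlim
    filter_upwards [self_mem_nhdsWithin] with s hs
    have hs : 0 < s := hs
    rw [hG.sub_eq hs ht, norm_smul, Complex.norm_real, Real.norm_eq_abs]
    gcongr
    exact (norm_mul_le _ _).trans (mul_le_mul (hG.norm_le s hs) (hG.norm_le t ht)
      (norm_nonneg _) (by positivity))
  exact ((continuousOn_const.mul hGc).mul continuousOn_const).norm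

/-- If `1 / l` is the norm of the Birman–Schwinger operator at `s`, then `-s` is an eigenvalue. -/
theorem eigenspace_ne_bot (hG : IsResolventFamily T G) (hP : IsSelfAdjoint P) (hPP : P * P = P)
    {s : ℝ} (hs : 0 < s) (hc : IsCompactOperator (G s * P)) {l : ℝ} (hl : 0 < l)
    (h : ‖P * G s * P‖ = 1 / l) : eigenspace (subBounded T P l) (-s : ℂ) ≠ ⊥ := by
  set K := P * G s * P with hK
  have hK0 : 0 ≤ K := by
    have := star_left_conjugate_nonneg (hG.nonneg s hs) P
    rwa [hP.star_eq] at this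
  have hKne : K ≠ 0 := by
    rw [← norm_ne_zero_iff, h]; positivity
  have : Nontrivial (H →L[ℂ] H) := ⟨K, 0, hKne⟩
  have hKc : IsCompactOperator K := by
    have := hc.clm_comp P
    exact this
  -- The norm of a positive operator belongs to its spectrum; by compactness a nonzero spectral
  -- value is an eigenvalue.
  have hmem : ((1 / l : ℝ) : ℂ) ∈ _root_.spectrum ℂ K := by
    have := CStarAlgebra.norm_mem_spectrum_of_nonneg (a := K) hK0
    rw [h] at this
    exact spectrum.algebraMap_mem ℂ this
  have hl' : (l : ℂ) ≠ 0 := by exact_mod_cast hl.ne'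
  have hne : ((1 / l : ℝ) : ℂ) ≠ 0 := by
    push_cast; exact one_div_ne_zero hl'
  obtain ⟨f, hf⟩ := ((hKc.hasEigenvalue_iff_mem_spectrum hne).2 hmem).exists_hasEigenvector
  have hKf : K f = ((1 / l : ℝ) : ℂ) • f := hf.apply_eq_smul
  have hf1 : f = (l : ℂ) • P (G s (P f)) := by
    have : P (G s (P f)) = K f := rfl
    rw [this, hKf, smul_smul]
    push_cast
    rw [mul_one_div_cancel hl', one_smul]
  have hPf : P f = f := by
    rw [hf1, map_smul]
    congr 1
    exact congrArg (fun A : H →L[ℂ] H => A (G s (P f))) hPP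
  rw [hPf] at hf1
  have hT := hG.right_inv s hs f
  rw [Submodule.ne_bot_iff]
  -- Since `f = l P G s f`, the vector `G s f` satisfies `(T + s) G s f = f = l P G s f`, and it is
  -- nonzero because `f` is.
  refine ⟨G s f, ⟨hG.mem_domain s hs f, ?_⟩, fun h0 => hf.2 ?_⟩
  · change T ⟨G s f, _⟩ - (l : ℂ) • P (G s f) = _
    rw [← hf1, sub_eq_iff_eq_add, neg_smul, neg_add_eq_sub, eq_sub_iff_add_eq]
    exact hT
  · rw [hf1, h0, map_zero, smul_zero]

/-! ### Negative eigenvalues are isolated and of finite multiplicity -/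

theorem finiteDimensional_eigenspace (hG : IsResolventFamily T G) {s : ℝ} (hs : 0 < s)
    (hc : IsCompactOperator (G s * P)) {l : ℝ} :
    FiniteDimensional ℂ (eigenspace (subBounded T P l) (-s : ℂ)) := by
  have hc' : IsCompactOperator ((l : ℂ) • (G s * P)) := hc.smul (l : ℂ)
  have := ContinuousLinearMap.finite_dimensional_eigenspace hc' 1 one_ne_zero
  refine Submodule.finiteDimensional_of_le (S₂ := Module.End.eigenspace
    ((l : ℂ) • (G s * P) : H →L[ℂ] H).toLinearMap 1) fun u hu => ?_
  rw [← add_zero (-s : ℂ)] at hu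
  have h := hG.eq_of_mem_eigenspace hs hu
  rw [zero_smul, zero_add] at h
  rw [Module.End.mem_eigenspace_iff, one_smul]
  exact h.symm

/-- A point off the spectrum of `T` that is not an eigenvalue of `T - l P` lies in the resolvent
set of `T - l P`. -/
theorem mem_resolventSet (hG : IsResolventFamily T G) {s : ℝ} (hs : 0 < s)
    (hc : IsCompactOperator (G s * P)) {l : ℝ} {ζ : ℂ} (hζ : ‖ζ‖ < s)
    (hne : eigenspace (subBounded T P l) (-s + ζ) = ⊥) :
    -s + ζ ∈ resolventSet (subBounded T P l) := by
  have hA : ‖ζ • G s‖ < 1 := by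
    rw [norm_smul]
    calc ‖ζ‖ * ‖G s‖ ≤ ‖ζ‖ * (1 / s) := by gcongr; exact hG.norm_le s hs
      _ < s * (1 / s) := by gcongr
      _ = 1 := by field_simp
  -- Composing `G s` with `T - l P - (-s + ζ)` gives `1 - ζ G s - l G s P = A (1 - C)`. The factor
  -- `A` is inverted by a Neumann series, and `C` is compact.
  set A := Units.oneSub (ζ • G s) hA with hAdef
  have hAv : (A : H →L[ℂ] H) = 1 - ζ • G s := rfl
  set C : H →L[ℂ] H := (l : ℂ) • ((↑A⁻¹ : H →L[ℂ] H) * (G s * P)) with hC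
  have hCc : IsCompactOperator C := (hc.clm_comp (↑A⁻¹ : H →L[ℂ] H)).smul (l : ℂ)
  have hAC : (A : H →L[ℂ] H) * C = (l : ℂ) • (G s * P) := by
    rw [hC, mul_smul_comm, ← mul_assoc, A.mul_inv, one_mul]
  -- Fredholm alternative: a fixed vector of `C` would be an eigenvector of `T - l P` at `-s + ζ`.
  have hW : IsUnit (1 - C) := by
    rcases hCc.hasEigenvalue_or_mem_resolventSet (one_ne_zero (α := ℂ)) with h | h
    · obtain ⟨v, hv⟩ := h.exists_hasEigenvector
      have hv1 : C v = v := by simpa using hv.apply_eq_smul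
      have h1 : (A : H →L[ℂ] H) v = (l : ℂ) • G s (P v) := by
        conv_lhs => rw [← hv1]
        exact congrArg (fun B : H →L[ℂ] H => B v) hAC
      have h2 : v - ζ • G s v = (l : ℂ) • G s (P v) := h1
      have hmem := hG.mem_eigenspace_of_eq hs (P := P) (l := l) (ζ := ζ) (u := v)
        (by rw [← h2]; abel)
      rw [hne, Submodule.mem_bot] at hmem
      exact absurd hmem hv.2
    · rw [spectrum.mem_resolventSet_iff, map_one] at h
      exact h
  obtain ⟨W, hWe⟩ : IsUnit (1 - ζ • G s - (l : ℂ) • (G s * P)) := by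
    have := A.isUnit.mul hW
    rwa [mul_sub, mul_one, hAC, hAv] at this
  have hWv : ∀ y, (W : H →L[ℂ] H) y = y - ζ • G s y - (l : ℂ) • G s (P y) := by
    intro y; rw [hWe]; rfl
  have hW1 : ∀ y, (W : H →L[ℂ] H) ((↑W⁻¹ : H →L[ℂ] H) y) = y := fun y =>
    congrArg (fun B : H →L[ℂ] H => B y) W.mul_inv
  have hW2 : ∀ y, (↑W⁻¹ : H →L[ℂ] H) ((W : H →L[ℂ] H) y) = y := fun y =>
    congrArg (fun B : H →L[ℂ] H => B y) W.inv_mul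
  refine ⟨(↑W⁻¹ : H →L[ℂ] H) * G s, fun f => ?_, fun u => ?_⟩
  · set y := (↑W⁻¹ : H →L[ℂ] H) (G s f) with hy
    have h1 : y - ζ • G s y - (l : ℂ) • G s (P y) = G s f := by rw [← hWv, hy, hW1]
    have h2 : y = G s (f + ζ • y + (l : ℂ) • P y) := by
      simp only [map_add, map_smul]
      rw [← h1]; abel
    have hd : y ∈ T.domain := by rw [h2]; exact hG.mem_domain s hs _
    refine ⟨hd, ?_⟩
    have h3 := hG.right_inv s hs (f + ζ • y + (l : ℂ) • P y)
    have h4 : (⟨G s (f + ζ • y + (l : ℂ) • P y), hG.mem_domain s hs _⟩ : T.domain) = ⟨y, hd⟩ :=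
      Subtype.ext h2.symm
    rw [h4, ← h2] at h3
    change T ⟨y, hd⟩ - (l : ℂ) • P y - (-(s : ℂ) + ζ) • y = f
    rw [eq_sub_iff_add_eq.2 h3]
    module
  · have hd : (u : H) ∈ T.domain := u.2
    have h1 : G s (T ⟨u, hd⟩ + (s : ℂ) • (u : H)) = u := hG.left_inv s hs ⟨u, hd⟩
    have h2 : subBounded T P l u - (-(s : ℂ) + ζ) • (u : H)
        = (T ⟨u, hd⟩ + (s : ℂ) • (u : H)) - ζ • (u : H) - (l : ℂ) • P u := by
      rw [subBounded_apply]; module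
    change (↑W⁻¹ : H →L[ℂ] H) (G s (subBounded T P l u - (-(s : ℂ) + ζ) • (u : H))) = u
    rw [h2, map_sub (G s), map_sub (G s), h1, map_smul (G s), map_smul (G s), ← hWv, hW2]

/-- Negative eigenvalues are isolated in the spectrum of `T - l P`. -/
theorem exists_isolated (hG : IsResolventFamily T G) (hP : IsSelfAdjoint P) {s : ℝ} (hs : 0 < s)
    (hc : IsCompactOperator (G s * P)) (l : ℝ) :
    ∃ r > 0, ∀ w ∈ spectrum (subBounded T P l), dist w (-s : ℂ) < r → w = -s := by
  by_contra! hcon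
  -- Otherwise spectral points accumulate at `-s`; by `mem_resolventSet` they are eigenvalues, with
  -- unit eigenvectors `u j`. A subsequence will converge to a unit eigenvector at `-s`, which is
  -- nevertheless orthogonal to every `u j`.
  have key : ∀ j : ℕ, ∃ (ζ : ℂ) (u : H), ‖ζ‖ < 1 / ((j : ℝ) + 1) ∧ ζ ≠ 0 ∧ ‖u‖ = 1 ∧
      u ∈ eigenspace (subBounded T P l) (-s + ζ) := by
    intro j
    obtain ⟨w, hw, hd, hne⟩ := hcon (min s (1 / ((j : ℝ) + 1))) (lt_min hs (by positivity))
    have hw' : w = -s + (w + s) := by ring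
    have hdist : ‖w + s‖ < min s (1 / ((j : ℝ) + 1)) := by
      rwa [dist_eq_norm, sub_neg_eq_add] at hd
    have hbot : eigenspace (subBounded T P l) (-s + (w + s)) ≠ ⊥ := by
      intro hb
      apply hw
      have := hG.mem_resolventSet hs hc (hdist.trans_le (min_le_left _ _)) hb
      rwa [← hw'] at this
    obtain ⟨u, hu, hu0⟩ := (Submodule.ne_bot_iff _).1 hbot
    refine ⟨w + s, ((‖u‖⁻¹ : ℝ) : ℂ) • u, hdist.trans_le (min_le_right _ _), ?_, ?_,
      Submodule.smul_mem _ _ hu⟩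
    · intro h
      exact hne (eq_neg_of_add_eq_zero_left h)
    · rw [norm_smul, Complex.norm_real, norm_inv, norm_norm,
        inv_mul_cancel₀ (norm_ne_zero_iff.2 hu0)]
  choose ζ u hζ hζ0 hu1 hu using key
  obtain ⟨K, hK, hKsub⟩ := IsCompactOperator.image_closedBall_subset_compact
    (𝕜₁ := ℂ) (f := ((G s * P : H →L[ℂ] H) : H →ₗ[ℂ] H)) hc 1
  have hin : ∀ j, G s (P (u j)) ∈ K := fun j =>
    hKsub ⟨u j, by simp [hu1 j], rfl⟩
  obtain ⟨y, -, φ, hφ, hy⟩ := hK.tendsto_subseq hin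
  have hζlim : Tendsto (fun j => ζ (φ j)) atTop (𝓝 0) := by
    have h0 : Tendsto ζ atTop (𝓝 0) := by
      rw [tendsto_zero_iff_norm_tendsto_zero]
      exact squeeze_zero (fun _ => norm_nonneg _) (fun j => (hζ j).le)
        tendsto_one_div_add_atTop_nhds_zero_nat
    exact h0.comp hφ.tendsto_atTop
  have hGlim : Tendsto (fun j => ζ (φ j) • G s (u (φ j))) atTop (𝓝 0) := by
    rw [tendsto_zero_iff_norm_tendsto_zero]
    refine squeeze_zero (fun _ => norm_nonneg _) (g := fun j => ‖ζ (φ j)‖ * ‖G s‖) (fun j => ?_) ?_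
    · rw [norm_smul]
      gcongr
      have := (G s).le_opNorm (u (φ j))
      rwa [hu1, mul_one] at this
    · simpa using hζlim.norm.mul_const ‖G s‖
  -- In `u = ζ G s u + l G s P u` the first term tends to zero and the second converges along `φ` by
  -- compactness.
  have hulim : Tendsto (fun j => u (φ j)) atTop (𝓝 ((l : ℂ) • y)) := by
    have := hGlim.add (hy.const_smul (l : ℂ))
    rw [zero_add] at this
    refine this.congr fun j => ?_
    exact (hG.eq_of_mem_eigenspace hs (hu (φ j))).symm
  set v := (l : ℂ) • y with hv
  have hv1 : ‖v‖ = 1 := by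
    have h1 := hulim.norm
    simp only [hu1] at h1
    exact tendsto_nhds_unique h1 tendsto_const_nhds
  have hvG : v = (l : ℂ) • G s (P v) := by
    have h1 : Tendsto (fun j => G s (P (u (φ j)))) atTop (𝓝 (G s (P v))) :=
      (((G s).continuous.comp P.continuous).tendsto v).comp hulim
    rw [← tendsto_nhds_unique hy h1]
  have hvmem : v ∈ eigenspace (subBounded T P l) (-s + 0) :=
    hG.mem_eigenspace_of_eq hs (by rw [zero_smul, zero_add]; exact hvG)
  clear_value v
  have horth : ∀ j, ⟪u j, v⟫_ℂ = 0 := by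
    intro j
    obtain ⟨hd, he⟩ := hu j
    obtain ⟨hd', he'⟩ := hvmem
    have h := hG.inner_subBounded_left hP l ⟨u j, hd⟩ ⟨v, hd'⟩
    rw [he, he', inner_smul_left, inner_smul_right] at h
    have h2 : (starRingEnd ℂ) (ζ j) * ⟪u j, v⟫_ℂ = 0 := by
      simp only [map_add, map_neg, Complex.conj_ofReal, add_zero] at h
      linear_combination h
    rcases mul_eq_zero.1 h2 with h3 | h3
    · exact absurd ((map_eq_zero _).1 h3) (hζ0 j)
    · exact h3
  have h1 : Tendsto (fun j => ⟪u (φ j), v⟫_ℂ) atTop (𝓝 ⟪v, v⟫_ℂ) :=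
    hulim.inner tendsto_const_nhds
  simp only [horth] at h1
  have h2 := tendsto_nhds_unique h1 tendsto_const_nhds
  rw [inner_self_eq_zero] at h2
  rw [h2, norm_zero] at hv1
  exact zero_ne_one hv1

/-! ### The coupling threshold -/

/-- By symmetry and nonnegativity an eigenvalue is real and `≥ 0`, hence a limit of the spectral
points slightly to its right. -/
theorem discreteSpectrum_eq_empty (hG : IsResolventFamily T G) (hP : IsSelfAdjoint P) {l : ℝ}
    (hn : IsNonneg (subBounded T P l))
    (hW : ∀ E : ℝ, 0 ≤ E → (E : ℂ) ∈ spectrum (subBounded T P l)) :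
    discreteSpectrum (subBounded T P l) = ∅ := by
  rw [Set.eq_empty_iff_forall_notMem]
  rintro z ⟨-, ⟨r, hr, hiso⟩, hne, -⟩
  obtain ⟨u, ⟨hd, hu⟩, hu0⟩ := (Submodule.ne_bot_iff _).1 hne
  have huu : ⟪u, u⟫_ℂ ≠ 0 := by rwa [Ne, inner_self_eq_zero]
  have h1 := hG.inner_subBounded_left hP l ⟨u, hd⟩ ⟨u, hd⟩
  rw [hu, inner_smul_left, inner_smul_right] at h1
  have hreal : (z.re : ℂ) = z := Complex.conj_eq_iff_re.1 (mul_right_cancel₀ huu h1)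
  have h2 := hn ⟨u, hd⟩
  rw [hu, inner_smul_right, ← hreal, Complex.re_ofReal_mul] at h2
  have h3 : 0 < (⟪u, u⟫_ℂ).re := by
    have : (⟪u, u⟫_ℂ).re = ‖u‖ ^ 2 := inner_self_eq_norm_sq (𝕜 := ℂ) u
    rw [this]
    have := norm_pos_iff.2 hu0
    positivity
  have hz : 0 ≤ z.re := nonneg_of_mul_nonneg_left h2 h3
  have h4 := hiso _ (hW (z.re + r / 2) (by positivity)) (by
    rw [← hreal, dist_eq_norm, ← Complex.ofReal_sub, Complex.norm_real, Complex.ofReal_re,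
      add_sub_cancel_left, Real.norm_eq_abs, abs_of_pos (by positivity)]
    linarith)
  have h5 := congrArg Complex.re h4
  rw [Complex.ofReal_re] at h5
  linarith

/-- Letting `s → 0` in `norm_sq_le` gives `‖P u‖² ≤ N ⟨u, T u⟩`, and `⟨u, P u⟩ = ‖P u‖²` for a
projection. The coupling `l` may be negative. -/
theorem isNonneg_subBounded (hG : IsResolventFamily T G) (hP : IsSelfAdjoint P) (hPP : P * P = P)
    {N l : ℝ} (hN : 0 < N) (hb : ∀ s, 0 < s → ‖P * G s * P‖ ≤ N) (hl : l ≤ 1 / N) :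
    IsNonneg (subBounded T P l) := by
  intro u
  have hd : (u : H) ∈ T.domain := u.2
  have hPu : ⟪(u : H), P u⟫_ℂ = ⟪P u, P u⟫_ℂ := by
    have h1 : ⟪P u, P u⟫_ℂ = ⟪(u : H), P (P u)⟫_ℂ := hP.isSymmetric u (P u)
    have h2 : P (P u) = P u := congrArg (fun B : H →L[ℂ] H => B (u : H)) hPP
    rw [h1, h2]
  have hPre : (⟪P u, P u⟫_ℂ).re = ‖P u‖ ^ 2 := inner_self_eq_norm_sq (𝕜 := ℂ) (P u)
  set a := (⟪(u : H), T ⟨u, hd⟩⟫_ℂ).re with ha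
  have h0 : ∀ s, 0 < s → ‖P u‖ ^ 2 / N ≤ a + s * ‖(u : H)‖ ^ 2 := by
    intro s hs
    have h := hG.norm_sq_le hP hs ⟨u, hd⟩
    have hpos : 0 ≤ a + s * ‖(u : H)‖ ^ 2 := hG.re_inner_add_nonneg hs ⟨u, hd⟩
    rw [div_le_iff₀ hN, mul_comm]
    exact h.trans (mul_le_mul_of_nonneg_right (hb s hs) hpos)
  have h1 : ‖P u‖ ^ 2 / N ≤ a := by
    have hlim : Tendsto (fun s : ℝ => a + s * ‖(u : H)‖ ^ 2) (𝓝[>] 0) (𝓝 a) := by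
      have : ContinuousAt (fun s : ℝ => a + s * ‖(u : H)‖ ^ 2) 0 := by fun_prop
      have h2 := this.tendsto.mono_left (nhdsWithin_le_nhds (s := Set.Ioi 0))
      simpa using h2
    exact ge_of_tendsto hlim (by filter_upwards [self_mem_nhdsWithin] with s hs using h0 s hs)
  change 0 ≤ (⟪(u : H), T ⟨u, hd⟩ - (l : ℂ) • P u⟫_ℂ).re
  rw [inner_sub_right, inner_smul_right, Complex.sub_re, Complex.re_ofReal_mul, hPu, hPre, ← ha]
  have h2 : l * ‖P u‖ ^ 2 ≤ 1 / N * ‖P u‖ ^ 2 := by gcongr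
  rw [one_div_mul_eq_div] at h2
  linarith

/-- Existence of a critical coupling constant for `T - l P`. -/
theorem exists_critical_coupling (hG : IsResolventFamily T G) (hP : IsSelfAdjoint P)
    (hPP : P * P = P) (hP0 : P ≠ 0) (hc : ∀ s, 0 < s → IsCompactOperator (G s * P))
    {C : ℝ} (hb : ∀ s, 0 < s → ‖P * G s * P‖ ≤ C)
    (hW : ∀ E : ℝ, 0 ≤ E → ∀ δ : ℝ, 0 < δ → ∃ u : T.domain, (u : H) ≠ 0 ∧
      ‖T u - (E : ℂ) • (u : H)‖ ≤ δ * ‖(u : H)‖ ∧ ‖P u‖ ≤ δ * ‖(u : H)‖) :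
    ∃ lc : ℝ, 0 < lc ∧ (∀ l < lc, discreteSpectrum (subBounded T P l) = ∅) ∧
      (∀ l > lc, ∃ E : ℝ, E < 0 ∧ (E : ℂ) ∈ discreteSpectrum (subBounded T P l)) ∧
      IsNonneg (subBounded T P lc) := by
  set S : Set ℝ := (fun s => ‖P * G s * P‖) '' Set.Ioi 0 with hS
  have hSb : BddAbove S := ⟨C, by rintro _ ⟨s, hs, rfl⟩; exact hb s hs⟩
  have hSn : S.Nonempty := ⟨_, 1, Set.mem_Ioi.2 one_pos, rfl⟩
  set N := sSup S with hN
  have hle : ∀ s, 0 < s → ‖P * G s * P‖ ≤ N := fun s hs => le_csSup hSb ⟨s, hs, rfl⟩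
  have hNpos : 0 < N :=
    (norm_pos_iff.2 (hG.mul_mul_ne_zero hP hP0 one_pos)).trans_le (hle 1 one_pos)
  have hspec : ∀ l E : ℝ, 0 ≤ E → (E : ℂ) ∈ spectrum (subBounded T P l) := fun l E hE =>
    mem_spectrum_of_approx (hW E hE) l
  refine ⟨1 / N, by positivity, fun l hl => ?_, fun l hl => ?_,
    hG.isNonneg_subBounded hP hPP hNpos hle le_rfl⟩
  · exact hG.discreteSpectrum_eq_empty hP (hG.isNonneg_subBounded hP hPP hNpos hle hl.le)
      (hspec l)
  · have hl0 : 0 < l := lt_trans (by positivity) hl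
    have hlN : 1 / l < N := by
      rw [gt_iff_lt, div_lt_iff₀ hNpos] at hl
      rw [div_lt_iff₀ hl0, mul_comm]; exact hl
    obtain ⟨_, ⟨a, ha, rfl⟩, hal⟩ := exists_lt_of_lt_csSup hSn hlN
    -- The lower end for the intermediate value theorem: at `s = l + 1` the resolvent bound already
    -- pushes the norm below `1 / l`, whereas at `a` it exceeds `1 / l`.
    have hbl : ‖P * G (l + 1) * P‖ ≤ 1 / l := by
      have hPn : ‖P‖ ≤ 1 := by
        have : ‖P‖ * ‖P‖ = ‖P‖ := by
          rw [← CStarRing.norm_star_mul_self, hP.star_eq, hPP]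
        have h0 : 0 < ‖P‖ := norm_pos_iff.2 hP0
        nlinarith
      have hGn := hG.norm_le (l + 1) (by positivity)
      calc ‖P * G (l + 1) * P‖ ≤ ‖P‖ * ‖G (l + 1)‖ * ‖P‖ :=
            (norm_mul_le _ _).trans (by gcongr; exact norm_mul_le _ _)
        _ ≤ 1 * (1 / (l + 1)) * 1 := by gcongr
        _ ≤ 1 / l := by
            rw [one_mul, mul_one]
            exact one_div_le_one_div_of_le hl0 (by linarith)
    obtain ⟨s, hs, hsl⟩ : 1 / l ∈ S := by
      refine ((isPreconnected_Ioi (a := (0 : ℝ))).image _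
        (hG.continuousOn_norm (P := P))).ordConnected.out ⟨l + 1, ?_, rfl⟩ ⟨a, ha, rfl⟩
        ⟨hbl, hal.le⟩
      change 0 < l + 1
      positivity
    have hs : 0 < s := hs
    have hne := hG.eigenspace_ne_bot hP hPP hs (hc s hs) hl0 hsl
    refine ⟨-s, by linarith, ?_⟩
    rw [Complex.ofReal_neg]
    refine ⟨?_, hG.exists_isolated hP hs (hc s hs) l, hne,
      hG.finiteDimensional_eigenspace hs (hc s hs)⟩
    rintro ⟨R, -, hR⟩
    obtain ⟨u, ⟨hd, hu⟩, hu0⟩ := (Submodule.ne_bot_iff _).1 hne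
    have h := hR ⟨u, hd⟩
    rw [hu, sub_self, map_zero] at h
    exact hu0 h.symm

end IsResolventFamily
end Abstract
end Schroedinger

namespace Schroedinger

open MeasureTheory TemperedDistribution Filter Topology FourierTransform
open scoped SchwartzMap Laplacian InnerProductSpace ENNReal

noncomputable section

/-- The Euclidean space `ℝⁿ`. -/
abbrev Rn (n : ℕ) : Type := EuclideanSpace ℝ (Fin n)

variable {n : ℕ}

/-! ### Multiplication operators and Fourier multipliers -/

/-- Multiplication by an essentially bounded function on `L²(ℝⁿ)`. -/
def mulCLM (φ : Rn n → ℂ) (hφ : MemLp φ ⊤ volume) : L2 n →L[ℂ] L2 n :=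
  (ContinuousLinearMap.mul ℂ ℂ).holderL volume ⊤ 2 2 (hφ.toLp φ)

theorem coeFn_mulCLM {φ : Rn n → ℂ} (hφ : MemLp φ ⊤ volume) (f : L2 n) :
    mulCLM φ hφ f =ᵐ[volume] fun x => φ x * f x := by
  filter_upwards [(ContinuousLinearMap.mul ℂ ℂ).coeFn_holder (r := 2) (hφ.toLp φ) f,
    hφ.coeFn_toLp] with x hx hx'
  rw [hx'] at hx
  exact hx

theorem norm_mulCLM_apply_le {φ : Rn n → ℂ} (hφ : MemLp φ ⊤ volume) {C : ℝ} (hC : ∀ x, ‖φ x‖ ≤ C)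
    (f : L2 n) : ‖mulCLM φ hφ f‖ ≤ C * ‖f‖ := by
  apply Lp.norm_le_mul_norm_of_ae_le_mul
  filter_upwards [coeFn_mulCLM hφ f] with x hx
  rw [hx, norm_mul]
  gcongr
  exact hC x

theorem inner_mulCLM_left {φ : Rn n → ℝ} (hφ : MemLp (fun x => (φ x : ℂ)) ⊤ volume) (f g : L2 n) :
    ⟪mulCLM _ hφ f, g⟫_ℂ = ⟪f, mulCLM _ hφ g⟫_ℂ := by
  rw [L2.inner_def, L2.inner_def]
  apply integral_congr_ae
  filter_upwards [coeFn_mulCLM hφ f, coeFn_mulCLM hφ g] with x hf hg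
  rw [hf, hg]
  simp only [RCLike.inner_apply, map_mul, Complex.conj_ofReal]
  ring

theorem re_inner_mulCLM_nonneg {φ : Rn n → ℝ} (hφ : MemLp (fun x => (φ x : ℂ)) ⊤ volume)
    (h0 : ∀ x, 0 ≤ φ x) (f : L2 n) : 0 ≤ (⟪mulCLM _ hφ f, f⟫_ℂ).re := by
  have h : ⟪mulCLM _ hφ f, f⟫_ℂ = ((∫ x, φ x * ‖f x‖ ^ 2 : ℝ) : ℂ) := by
    rw [L2.inner_def, ← integral_complex_ofReal]
    apply integral_congr_ae
    filter_upwards [coeFn_mulCLM hφ f] with x hf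
    rw [hf]
    simp only [RCLike.inner_apply, map_mul, Complex.conj_ofReal]
    rw [mul_left_comm, Complex.mul_conj, Complex.normSq_eq_norm_sq]
    push_cast
    ring
  rw [h, Complex.ofReal_re]
  exact integral_nonneg fun x => mul_nonneg (h0 x) (by positivity)

/-- The Fourier multiplier with an essentially bounded symbol on `L²(ℝⁿ)`. -/
def fourierMul (φ : Rn n → ℂ) (hφ : MemLp φ ⊤ volume) : L2 n →L[ℂ] L2 n :=
  ((Lp.fourierTransformₗᵢ (Rn n) ℂ).symm : L2 n →L[ℂ] L2 n) ∘L mulCLM φ hφ ∘L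
    ((Lp.fourierTransformₗᵢ (Rn n) ℂ) : L2 n →L[ℂ] L2 n)

theorem fourierMul_apply {φ : Rn n → ℂ} (hφ : MemLp φ ⊤ volume) (f : L2 n) :
    fourierMul φ hφ f = (𝓕⁻ (mulCLM φ hφ (𝓕 f)) : L2 n) := rfl

theorem fourier_fourierMul {φ : Rn n → ℂ} (hφ : MemLp φ ⊤ volume) (f : L2 n) :
    (𝓕 (fourierMul φ hφ f) : L2 n) = mulCLM φ hφ (𝓕 f) := by
  rw [fourierMul_apply, fourier_fourierInv_eq]

theorem inner_fourierMul_left {φ : Rn n → ℂ} (hφ : MemLp φ ⊤ volume) (f g : L2 n) :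
    ⟪fourierMul φ hφ f, g⟫_ℂ = ⟪mulCLM φ hφ (𝓕 f), (𝓕 g : L2 n)⟫_ℂ := by
  rw [← Lp.inner_fourier_eq, fourier_fourierMul]

theorem inner_fourierMul_right {φ : Rn n → ℂ} (hφ : MemLp φ ⊤ volume) (f g : L2 n) :
    ⟪f, fourierMul φ hφ g⟫_ℂ = ⟪(𝓕 f : L2 n), mulCLM φ hφ (𝓕 g)⟫_ℂ := by
  rw [← Lp.inner_fourier_eq, fourier_fourierMul]

theorem norm_fourierMul_le {φ : Rn n → ℂ} (hφ : MemLp φ ⊤ volume) {C : ℝ} (hC : ∀ x, ‖φ x‖ ≤ C)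
    (hC0 : 0 ≤ C) : ‖fourierMul φ hφ‖ ≤ C := by
  refine ContinuousLinearMap.opNorm_le_bound _ hC0 fun f => ?_
  rw [← Lp.norm_fourier_eq, fourier_fourierMul, ← Lp.norm_fourier_eq f]
  exact norm_mulCLM_apply_le hφ hC _

theorem fourierMul_nonneg {φ : Rn n → ℝ} (hφ : MemLp (fun x => (φ x : ℂ)) ⊤ volume)
    (h0 : ∀ x, 0 ≤ φ x) : 0 ≤ fourierMul _ hφ := by
  rw [ContinuousLinearMap.nonneg_iff_isPositive]
  refine ⟨fun f g => ?_, fun f => ?_⟩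
  · change ⟪fourierMul _ hφ f, g⟫_ℂ = ⟪f, fourierMul _ hφ g⟫_ℂ
    rw [inner_fourierMul_left, inner_fourierMul_right, inner_mulCLM_left]
  · change 0 ≤ (⟪fourierMul _ hφ f, f⟫_ℂ).re
    rw [inner_fourierMul_left]
    exact re_inner_mulCLM_nonneg hφ h0 _

/-! ### The Laplacian on the Fourier side -/

/-- Bridge from identities of tempered distributions to almost-everywhere identities, by testing
against smooth compactly supported functions. -/
theorem smulLeftCLM_eq_iff {g : Rn n → ℂ} (hg : g.HasTemperateGrowth) (u w : L2 n) :
    smulLeftCLM ℂ g (u : 𝓢'(Rn n, ℂ)) = (w : 𝓢'(Rn n, ℂ)) ↔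
      w =ᵐ[volume] fun x => g x * u x := by
  constructor
  · intro h
    have hu : LocallyIntegrable u volume := (Lp.memLp u).locallyIntegrable (by norm_num)
    have hw : LocallyIntegrable w volume := (Lp.memLp w).locallyIntegrable (by norm_num)
    have hgu : LocallyIntegrable (fun x => g x * u x) volume := by
      rw [← locallyIntegrableOn_univ] at hu ⊢
      exact hu.continuousOn_mul hg.1.continuous.continuousOn isOpen_univ.isLocallyClosed
    refine ae_eq_of_integral_contDiff_smul_eq hw hgu fun φ hφ hφc => ?_
    have hφ₁ : HasCompactSupport (Complex.ofRealCLM ∘ φ) := hφc.comp_left rfl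
    have hφ₂ : ContDiff ℝ (⊤ : ℕ∞) (Complex.ofRealCLM ∘ φ) :=
      Complex.ofRealCLM.contDiff.comp hφ
    have h2 := congrArg (fun d : 𝓢'(Rn n, ℂ) => d (hφ₁.toSchwartzMap hφ₂)) h
    simp only [smulLeftCLM_apply_apply, Lp.toTemperedDistribution_apply,
      SchwartzMap.smulLeftCLM_apply_apply hg] at h2
    refine Eq.trans ?_ (h2.symm.trans ?_)
    · rfl
    · refine integral_congr_ae (Eventually.of_forall fun x => ?_)
      simp [mul_left_comm, mul_assoc]
  · intro h
    ext φ
    simp only [smulLeftCLM_apply_apply, Lp.toTemperedDistribution_apply,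
      SchwartzMap.smulLeftCLM_apply_apply hg]
    apply integral_congr_ae
    filter_upwards [h] with x hx
    rw [hx]
    simp only [smul_eq_mul]
    ring

/-- The symbol `|2πξ|²` of `-Δ`. -/
def symbol (ξ : Rn n) : ℝ := (2 * Real.pi) ^ 2 * ‖ξ‖ ^ 2

theorem symbol_nonneg (ξ : Rn n) : 0 ≤ symbol ξ := by unfold symbol; positivity

theorem continuous_symbol : Continuous (symbol : Rn n → ℝ) := by unfold symbol; fun_prop

theorem fourier_negLaplacian (u : (negLaplacian n).domain) :
    (𝓕 (negLaplacian n u) : L2 n) =ᵐ[volume]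
      fun ξ => (symbol ξ : ℂ) * (𝓕 (u : L2 n) : L2 n) ξ := by
  have hg : (fun ξ : Rn n => (symbol ξ : ℂ)).HasTemperateGrowth := by
    unfold symbol; fun_prop
  have hg' : (fun ξ : Rn n => Complex.ofReal (‖ξ‖ ^ 2)).HasTemperateGrowth := by
    fun_prop
  rw [← smulLeftCLM_eq_iff hg]
  have h1 : (negLaplacian n u : L2 n) = -laplacianL2 u := rfl
  have h2 := laplacianL2_spec u
  rw [laplacian_eq_fourierMultiplierCLM, fourierMultiplierCLM_apply] at h2
  rw [h1, ← Lp.fourier_toTemperedDistribution_eq, ← Lp.fourier_toTemperedDistribution_eq]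
  rw [← Lp.toTemperedDistributionCLM_apply (-_), map_neg, Lp.toTemperedDistributionCLM_apply, ← h2]
  have h3 : (fun ξ : Rn n => (symbol ξ : ℂ)) =
      (((2 * Real.pi) ^ 2 : ℝ) : ℂ) • fun ξ : Rn n => Complex.ofReal (‖ξ‖ ^ 2) := by
    ext ξ; simp [symbol]
  rw [h3, smulLeftCLM_smul hg', ← neg_smul, neg_neg, ← Complex.coe_smul,
    FourierTransform.fourier_smul, fourier_fourierInv_eq]
  rfl

theorem fourierInv_mem_sobolevH2 {w v : L2 n}
    (h : v =ᵐ[volume] fun ξ => (symbol ξ : ℂ) * w ξ) :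
    (𝓕⁻ w : L2 n) ∈ (negLaplacian n).domain := by
  change MemSobolev 2 2 ((𝓕⁻ w : L2 n) : 𝓢'(Rn n, ℂ))
  rw [memSobolev_iff_exists_smulLeftCLM_fourier]
  -- This is `(1 + |ξ|²) w`, because `v = (2π)² |ξ|² w`.
  refine ⟨w + (((2 * Real.pi) ^ 2)⁻¹ : ℂ) • v, ?_⟩
  rw [Lp.fourier_toTemperedDistribution_eq, fourier_fourierInv_eq, smulLeftCLM_eq_iff (by fun_prop)]
  filter_upwards [Lp.coeFn_add w ((((2 * Real.pi) ^ 2)⁻¹ : ℂ) • v),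
    Lp.coeFn_smul (((2 * Real.pi) ^ 2)⁻¹ : ℂ) v, h] with x h1 h2 h3
  rw [h1, Pi.add_apply, h2, Pi.smul_apply, h3]
  have hpi : (Real.pi : ℂ) ≠ 0 := by exact_mod_cast Real.pi_ne_zero
  simp only [symbol, smul_eq_mul]
  norm_num
  field_simp

theorem negLaplacian_fourierInv {w v : L2 n}
    (h : v =ᵐ[volume] fun ξ => (symbol ξ : ℂ) * w ξ) :
    negLaplacian n ⟨(𝓕⁻ w : L2 n), fourierInv_mem_sobolevH2 h⟩ = (𝓕⁻ v : L2 n) := by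
  have h1 := fourier_negLaplacian ⟨(𝓕⁻ w : L2 n), fourierInv_mem_sobolevH2 h⟩
  simp only [fourier_fourierInv_eq] at h1
  rw [← fourierInv_fourier_eq (F := L2 n)
    (negLaplacian n ⟨(𝓕⁻ w : L2 n), fourierInv_mem_sobolevH2 h⟩)]
  congr 1
  exact Lp.ext (h1.trans h.symm)

/-! ### The free resolvent -/

theorem memLp_resolventSymbol {s : ℝ} (hs : 0 < s) :
    MemLp (fun ξ : Rn n => (((symbol ξ + s)⁻¹ : ℝ) : ℂ)) ⊤ volume := by
  refine memLp_top_of_bound ?_ s⁻¹ (Eventually.of_forall fun ξ => ?_)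
  · have : ∀ ξ : Rn n, symbol ξ + s ≠ 0 := fun ξ =>
      (add_pos_of_nonneg_of_pos (symbol_nonneg ξ) hs).ne'
    exact (Complex.continuous_ofReal.comp
      ((continuous_symbol.add continuous_const).inv₀ this)).aestronglyMeasurable
  · rw [Complex.norm_real, Real.norm_eq_abs,
      abs_of_nonneg (inv_nonneg.2 (by linarith [symbol_nonneg ξ]))]
    exact inv_anti₀ hs (by linarith [symbol_nonneg ξ])

theorem norm_resolventSymbol_le {s : ℝ} (hs : 0 < s) (ξ : Rn n) :
    ‖(((symbol ξ + s)⁻¹ : ℝ) : ℂ)‖ ≤ 1 / s := by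
  rw [Complex.norm_real, Real.norm_eq_abs,
    abs_of_nonneg (inv_nonneg.2 (by linarith [symbol_nonneg ξ])), one_div]
  exact inv_anti₀ hs (by linarith [symbol_nonneg ξ])

/-- The resolvent `(-Δ + s)⁻¹` for `s > 0`. -/
def freeResolvent (n : ℕ) (s : ℝ) : L2 n →L[ℂ] L2 n :=
  if hs : 0 < s then fourierMul _ (memLp_resolventSymbol hs) else 0

theorem freeResolvent_of_pos {s : ℝ} (hs : 0 < s) :
    freeResolvent n s = fourierMul _ (memLp_resolventSymbol hs) := dif_pos hs

theorem isResolventFamily (n : ℕ) : IsResolventFamily (negLaplacian n) (freeResolvent n) := by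
  have hae : ∀ (s : ℝ) (hs : 0 < s) (f : L2 n),
      ((𝓕 f : L2 n) - (s : ℂ) • mulCLM _ (memLp_resolventSymbol hs) (𝓕 f) : L2 n) =ᵐ[volume]
        fun ξ => (symbol ξ : ℂ) * mulCLM _ (memLp_resolventSymbol hs) (𝓕 f) ξ := by
    intro s hs f
    filter_upwards [Lp.coeFn_sub (𝓕 f : L2 n) ((s : ℂ) • mulCLM _ (memLp_resolventSymbol hs) (𝓕 f)),
      Lp.coeFn_smul (s : ℂ) (mulCLM _ (memLp_resolventSymbol hs) (𝓕 f)),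
      coeFn_mulCLM (memLp_resolventSymbol hs) (𝓕 f)] with ξ h1 h2 h3
    have h0 : (symbol ξ + s : ℂ) ≠ 0 := by
      have : 0 < symbol ξ + s := by linarith [symbol_nonneg ξ]
      exact_mod_cast this.ne'
    rw [h1, Pi.sub_apply, h2, Pi.smul_apply, h3]
    simp only [smul_eq_mul, Complex.ofReal_inv, Complex.ofReal_add]
    field_simp
    ring
  have hmem : ∀ s, 0 < s → ∀ f, freeResolvent n s f ∈ (negLaplacian n).domain := by
    intro s hs f
    rw [freeResolvent_of_pos hs]
    exact fourierInv_mem_sobolevH2 (hae s hs f)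
  refine ⟨hmem, fun s hs f => ?_, fun s hs u => ?_, fun s hs => ?_, fun s hs => ?_⟩
  · have h := negLaplacian_fourierInv (hae s hs f)
    have h2 : (⟨freeResolvent n s f, hmem s hs f⟩ : (negLaplacian n).domain) =
        ⟨_, fourierInv_mem_sobolevH2 (hae s hs f)⟩ := by
      apply Subtype.ext
      change freeResolvent n s f = _
      rw [freeResolvent_of_pos hs]; rfl
    rw [h2, h, freeResolvent_of_pos hs, fourierMul_apply, ← FourierTransform.fourierInv_smul,
      ← FourierTransform.fourierInv_add, sub_add_cancel, fourierInv_fourier_eq]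
  · rw [freeResolvent_of_pos hs, fourierMul_apply, ← fourierInv_fourier_eq (F := L2 n) (u : L2 n)]
    congr 1
    rw [fourierInv_fourier_eq]
    apply Lp.ext
    rw [FourierTransform.fourier_add, FourierTransform.fourier_smul]
    filter_upwards [coeFn_mulCLM (memLp_resolventSymbol hs)
      ((𝓕 (negLaplacian n u) : L2 n) + (s : ℂ) • (𝓕 (u : L2 n) : L2 n)),
      Lp.coeFn_add (𝓕 (negLaplacian n u) : L2 n) ((s : ℂ) • (𝓕 (u : L2 n) : L2 n)),
      Lp.coeFn_smul (s : ℂ) (𝓕 (u : L2 n) : L2 n), fourier_negLaplacian u] with ξ h1 h2 h3 h4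
    have h0 : (symbol ξ + s : ℂ) ≠ 0 := by
      have : 0 < symbol ξ + s := by linarith [symbol_nonneg ξ]
      exact_mod_cast this.ne'
    rw [h1, h2, Pi.add_apply, h3, Pi.smul_apply, h4]
    simp only [smul_eq_mul, Complex.ofReal_inv, Complex.ofReal_add]
    field_simp
  · rw [freeResolvent_of_pos hs]
    exact fourierMul_nonneg _ fun ξ => inv_nonneg.2 (by linarith [symbol_nonneg ξ])
  · rw [freeResolvent_of_pos hs]
    exact norm_fourierMul_le _ (norm_resolventSymbol_le hs) (by positivity)

/-! ### The projection onto functions supported in the unit ball -/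

/-- The indicator function of the open unit ball. -/
def ballInd (x : Rn n) : ℝ := (Metric.ball (0 : Rn n) 1).indicator (fun _ => (1 : ℝ)) x

theorem memLp_ballInd : MemLp (fun x : Rn n => (ballInd x : ℂ)) ⊤ volume := by
  refine memLp_top_of_bound ?_ 1 (Eventually.of_forall fun x => ?_)
  · exact (Complex.measurable_ofReal.comp
      (measurable_const.indicator measurableSet_ball)).aestronglyMeasurable
  · by_cases hx : x ∈ Metric.ball (0 : Rn n) 1 <;> simp [ballInd, hx]

/-- Multiplication by the indicator function of the unit ball. -/
def ballProj (n : ℕ) : L2 n →L[ℂ] L2 n := mulCLM _ (memLp_ballInd (n := n))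

theorem coeFn_ballProj (f : L2 n) :
    ballProj n f =ᵐ[volume] fun x => (ballInd x : ℂ) * f x := coeFn_mulCLM _ f

theorem inner_ballProj_left (f g : L2 n) : ⟪ballProj n f, g⟫_ℂ = ⟪f, ballProj n g⟫_ℂ :=
  inner_mulCLM_left _ f g

theorem isSelfAdjoint_ballProj : IsSelfAdjoint (ballProj n) := by
  rw [ContinuousLinearMap.isSelfAdjoint_iff_isSymmetric]
  exact fun f g => inner_ballProj_left f g

theorem ballProj_ballProj (f : L2 n) : ballProj n (ballProj n f) = ballProj n f := by
  apply Lp.ext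
  filter_upwards [coeFn_ballProj (ballProj n f), coeFn_ballProj f] with x h1 h2
  rw [h1, h2]
  by_cases hx : x ∈ Metric.ball (0 : Rn n) 1 <;> simp [ballInd, hx]

theorem norm_ballProj_le (f : L2 n) : ‖ballProj n f‖ ≤ ‖f‖ := by
  have := norm_mulCLM_apply_le (memLp_ballInd (n := n)) (C := 1) (fun x => by
    by_cases hx : x ∈ Metric.ball (0 : Rn n) 1 <;> simp [ballInd, hx]) f
  rwa [one_mul] at this

/-- The indicator function of the unit ball as an element of `L²`. -/
def ballVec (n : ℕ) : L2 n :=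
  indicatorConstLp 2 (measurableSet_ball (x := (0 : Rn n)) (ε := 1)) measure_ball_lt_top.ne (1 : ℂ)

theorem ballProj_ne_zero : ballProj n ≠ 0 := by
  intro h
  have h1 : ballProj n (ballVec n) = ballVec n := by
    apply Lp.ext
    filter_upwards [coeFn_ballProj (ballVec n), indicatorConstLp_coeFn (p := 2)
      (hs := measurableSet_ball (x := (0 : Rn n)) (ε := 1)) (hμs := measure_ball_lt_top.ne)
      (c := (1 : ℂ))] with x h1 h2
    rw [h1]
    by_cases hx : x ∈ Metric.ball (0 : Rn n) 1
    · simp [ballInd, hx]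
    · change ballVec n x = _ at h2
      rw [h2]
      simp [hx]
  rw [h] at h1
  have h2 : ‖ballVec n‖ = 0 := by rw [← h1]; simp
  rw [ballVec, norm_indicatorConstLp (by norm_num) (by norm_num), norm_one, one_mul] at h2
  have h3 : 0 < (volume : Measure (Rn n)).real (Metric.ball 0 1) :=
    ENNReal.toReal_pos (Metric.measure_ball_pos _ _ one_pos).ne' measure_ball_lt_top.ne
  exact (Real.rpow_pos_of_pos h3 _).ne' h2

/-- The potential is bounded, so its maximal multiplication domain is all of `L²` and the operator
sum is a bounded perturbation of `-Δ`. -/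
theorem schrodinger_well (n : ℕ) (l : ℝ) :
    schrodinger (well n l) = subBounded (negLaplacian n) (ballProj n) l := by
  have hae : ∀ u : L2 n, (fun x => (well n l x : ℂ) * u x) =ᵐ[volume]
      (-((l : ℂ) • ballProj n u) : L2 n) := by
    intro u
    filter_upwards [Lp.coeFn_neg ((l : ℂ) • ballProj n u), Lp.coeFn_smul (l : ℂ) (ballProj n u),
      coeFn_ballProj u] with x h1 h2 h3
    rw [h1, Pi.neg_apply, h2, Pi.smul_apply, h3]
    simp only [well, ballInd, smul_eq_mul]
    push_cast
    ring
  have hmem : ∀ u : L2 n, u ∈ mulDomain (well n l) := fun u => (Lp.memLp _).ae_eq (hae u).symm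
  refine LinearPMap.ext ?_ ?_
  · exact le_antisymm inf_le_left fun u hu => ⟨hu, hmem u⟩
  · intro u hu hu'
    refine (LinearPMap.add_apply (negLaplacian n) (mulOperator (well n l)) ⟨u, hu⟩).trans ?_
    rw [subBounded_apply, sub_eq_add_neg]
    congr 1
    apply Lp.ext
    refine EventuallyEq.trans ?_ (hae u)
    exact MemLp.coeFn_toLp (memLp_of_mem_mulDomain (hmem u))

/-! ### The Fourier transform of functions supported in the unit ball -/

/-- The `L²` Fourier transform is given by the Fourier integral on integrable functions. -/
theorem coeFn_fourier_of_integrable {g : L2 n} (hg : Integrable g volume) :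
    (𝓕 g : L2 n) =ᵐ[volume] 𝓕 (g : Rn n → ℂ) := by
  have h1 : LocallyIntegrable (𝓕 g : L2 n) volume :=
    (Lp.memLp (𝓕 g : L2 n)).locallyIntegrable (by norm_num)
  have hcont : Continuous (𝓕 (g : Rn n → ℂ)) :=
    VectorFourier.fourierIntegral_continuous Real.continuous_fourierChar
      (by exact continuous_inner) hg
  refine ae_eq_of_integral_contDiff_smul_eq h1 hcont.locallyIntegrable fun φ hφ hφc => ?_
  have hφ₁ : HasCompactSupport (Complex.ofRealCLM ∘ φ) := hφc.comp_left rfl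
  have hφ₂ : ContDiff ℝ (⊤ : ℕ∞) (Complex.ofRealCLM ∘ φ) := Complex.ofRealCLM.contDiff.comp hφ
  set ψ := hφ₁.toSchwartzMap hφ₂ with hψ
  have h2 := congrArg (fun d : 𝓢'(Rn n, ℂ) => d ψ) (Lp.fourier_toTemperedDistribution_eq g)
  simp only [TemperedDistribution.fourier_apply, Lp.toTemperedDistribution_apply] at h2
  have h3 := VectorFourier.integral_fourierIntegral_smul_eq_flip (e := Real.fourierChar)
    (μ := (volume : Measure (Rn n))) (ν := (volume : Measure (Rn n))) (L := innerₗ (Rn n))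
    (f := ψ) (g := g) Real.continuous_fourierChar (by exact continuous_inner) ψ.integrable hg
  rw [flip_innerₗ] at h3
  exact h2.symm.trans h3

theorem memLp_ballChar (ξ : Rn n) :
    MemLp (fun x => (ballInd x : ℂ) * (Real.fourierChar (inner ℝ x ξ) : ℂ)) 2 volume := by
  refine MemLp.of_le (memLp_indicator_const 2 (measurableSet_ball (x := (0 : Rn n)) (ε := 1))
    (1 : ℂ) (Or.inr measure_ball_lt_top.ne)) ?_ (Eventually.of_forall fun x => ?_)
  · refine memLp_ballInd.1.mul (Continuous.aestronglyMeasurable ?_)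
    exact continuous_subtype_val.comp (Real.continuous_fourierChar.comp (by fun_prop))
  · rw [norm_mul, Circle.norm_coe]
    by_cases hx : x ∈ Metric.ball (0 : Rn n) 1 <;> simp [ballInd, hx]

/-- The character `e^{2πi⟨x, ξ⟩}` restricted to the unit ball. -/
def ballChar (ξ : Rn n) : L2 n := (memLp_ballChar ξ).toLp _

theorem norm_ballChar_le (ξ : Rn n) : ‖ballChar ξ‖ ≤ ‖ballVec n‖ := by
  apply Lp.norm_le_norm_of_ae_le
  filter_upwards [(memLp_ballChar ξ).coeFn_toLp, indicatorConstLp_coeFn (p := 2)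
      (hs := measurableSet_ball (x := (0 : Rn n)) (ε := 1)) (hμs := measure_ball_lt_top.ne)
      (c := (1 : ℂ))] with x h1 h2
  change ballVec n x = _ at h2
  change ballChar ξ x = _ at h1
  rw [h1, h2, norm_mul, Circle.norm_coe]
  by_cases hx : x ∈ Metric.ball (0 : Rn n) 1 <;> simp [ballInd, hx]

theorem norm_fourierChar_sub_le (a b : ℝ) :
    ‖(Real.fourierChar a : ℂ) - (Real.fourierChar b : ℂ)‖ ≤ 2 * Real.pi * |a - b| := by
  have h : (Real.fourierChar a : ℂ) =
      (Real.fourierChar b : ℂ) * (Real.fourierChar (a - b) : ℂ) := by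
    rw [← Circle.coe_mul, ← AddChar.map_add_eq_mul, add_sub_cancel]
  rw [h, ← mul_sub_one, norm_mul, Circle.norm_coe, one_mul, Real.fourierChar_apply, mul_comm]
  refine (Real.norm_exp_I_mul_ofReal_sub_one_le (x := 2 * Real.pi * (a - b))).trans ?_
  rw [Real.norm_eq_abs, abs_mul, abs_of_pos (by positivity)]

/-- The phase is Lipschitz in the frequency because `|x| ≤ 1` on the ball; this allows a finite net
of frequencies in the compactness proof. -/
theorem norm_ballChar_sub_le (ξ η : Rn n) :
    ‖ballChar ξ - ballChar η‖ ≤ 2 * Real.pi * ‖ξ - η‖ * ‖ballVec n‖ := by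
  apply Lp.norm_le_mul_norm_of_ae_le_mul
  filter_upwards [(memLp_ballChar ξ).coeFn_toLp, (memLp_ballChar η).coeFn_toLp,
    Lp.coeFn_sub (ballChar ξ) (ballChar η), indicatorConstLp_coeFn (p := 2)
      (hs := measurableSet_ball (x := (0 : Rn n)) (ε := 1)) (hμs := measure_ball_lt_top.ne)
      (c := (1 : ℂ))] with x h1 h1' h3 h2
  change ballVec n x = _ at h2
  change ballChar ξ x = _ at h1
  change ballChar η x = _ at h1'
  rw [h3, Pi.sub_apply, h1, h1', h2]
  by_cases hx : x ∈ Metric.ball (0 : Rn n) 1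
  · have hx' : ‖x‖ ≤ 1 := (mem_ball_zero_iff.1 hx).le
    simp only [ballInd, hx, Set.indicator_of_mem, Complex.ofReal_one, one_mul, norm_one, mul_one]
    refine (norm_fourierChar_sub_le _ _).trans ?_
    rw [← inner_sub_right]
    gcongr
    exact (abs_real_inner_le_norm _ _).trans (mul_le_of_le_one_left (norm_nonneg _) hx')
  · simp [ballInd, hx]

/-- A function in `L²` of the ball is integrable, so its Fourier transform has point values, and
these are bounded linear functionals of `f`. Both the compactness and the uniform bound rest on
this. -/
theorem coeFn_fourier_ballProj (f : L2 n) :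
    (𝓕 (ballProj n f) : L2 n) =ᵐ[volume] fun ξ => ⟪ballChar ξ, f⟫_ℂ := by
  have hint : Integrable (ballProj n f) volume := by
    have h1 : IntegrableOn f (Metric.ball 0 1) volume := by
      have : IsFiniteMeasure ((volume : Measure (Rn n)).restrict (Metric.ball 0 1)) :=
        ⟨by rw [Measure.restrict_apply_univ]; exact measure_ball_lt_top⟩
      exact ((Lp.memLp f).restrict _).integrable (by norm_num)
    refine (h1.integrable_indicator measurableSet_ball).congr ?_
    filter_upwards [coeFn_ballProj f] with x hx
    rw [hx]
    by_cases hx : x ∈ Metric.ball (0 : Rn n) 1 <;> simp [ballInd, hx]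
  refine (coeFn_fourier_of_integrable hint).trans (Eventually.of_forall fun ξ => ?_)
  change 𝓕 (ballProj n f : Rn n → ℂ) ξ = ⟪ballChar ξ, f⟫_ℂ
  rw [Real.fourier_eq, L2.inner_def]
  apply integral_congr_ae
  filter_upwards [coeFn_ballProj f, (memLp_ballChar ξ).coeFn_toLp] with x h1 h2
  change ballChar ξ x = _ at h2
  rw [h1, h2, Circle.smul_def, AddChar.map_neg_eq_inv, Circle.coe_inv_eq_conj]
  simp only [RCLike.inner_apply, map_mul, Complex.conj_ofReal, smul_eq_mul]
  ring

theorem norm_fourier_ballProj_le (f : L2 n) :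
    ∀ᵐ ξ, ‖(𝓕 (ballProj n f) : L2 n) ξ‖ ≤ ‖ballVec n‖ * ‖f‖ := by
  filter_upwards [coeFn_fourier_ballProj f] with ξ hξ
  rw [hξ]
  exact (norm_inner_le_norm _ _).trans (by gcongr; exact norm_ballChar_le ξ)

/-! ### Compactness -/

/-- An operator that is controlled by finite-rank operators up to arbitrarily small errors is
compact. -/
theorem isCompactOperator_of_norm_le {H : Type*} [NormedAddCommGroup H] [NormedSpace ℂ H]
    [CompleteSpace H] {T : H →L[ℂ] H}
    (h : ∀ ε : ℝ, 0 < ε → ∃ (ι : Type) (_ : Fintype ι) (L : H →L[ℂ] (ι → ℂ)),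
      ∀ f, ‖T f‖ ≤ ‖L f‖ + ε * ‖f‖) : IsCompactOperator T := by
  refine (isCompactOperator_iff_isCompact_closure_image_closedBall (T : H →ₗ[ℂ] H) one_pos).2 ?_
  refine TotallyBounded.isCompact_of_isClosed (TotallyBounded.closure ?_) isClosed_closure
  rw [Metric.totallyBounded_iff]
  intro ε hε
  obtain ⟨ι, _, L, hL⟩ := h (ε / 4) (by positivity)
  have hb : Bornology.IsBounded (L '' Metric.closedBall 0 1) :=
    L.lipschitz.isBounded_image Metric.isBounded_closedBall
  have htb : TotallyBounded (L '' Metric.closedBall 0 1) :=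
    hb.isCompact_closure.totallyBounded.subset subset_closure
  -- The image under `L` is bounded in finite dimension, hence has a finite net; its preimages
  -- furnish the net for `T`.
  obtain ⟨t, hts, htf, htc⟩ := totallyBounded_iff_subset.1 htb _
    (Metric.dist_mem_uniformity (half_pos hε))
  have hts' : ∀ y ∈ t, ∃ x ∈ Metric.closedBall (0 : H) 1, L x = y := fun y hy => hts hy
  choose! g hg using hts'
  refine ⟨(fun y => T (g y)) '' t, htf.image _, ?_⟩
  rintro _ ⟨x, hx, rfl⟩
  obtain ⟨y, hy, hxy⟩ := Set.mem_iUnion₂.1 (htc ⟨x, hx, rfl⟩)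
  refine Set.mem_iUnion₂.2 ⟨T (g y), ⟨y, hy, rfl⟩, ?_⟩
  obtain ⟨hgy, hLy⟩ := hg y hy
  have hxy : ‖L x - y‖ < ε / 2 := by rw [← dist_eq_norm]; exact hxy
  have h1 : ‖x‖ ≤ 1 := by simpa using hx
  have h2 : ‖g y‖ ≤ 1 := by simpa using hgy
  have h3 := hL (x - g y)
  rw [map_sub, map_sub, hLy] at h3
  rw [Metric.mem_ball, dist_eq_norm]
  have h4 : ‖x - g y‖ ≤ 2 := (norm_sub_le _ _).trans (by linarith)
  calc ‖T x - T (g y)‖ ≤ ‖L x - y‖ + ε / 4 * ‖x - g y‖ := h3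
    _ < ε / 2 + ε / 4 * 2 := add_lt_add_of_lt_of_le hxy (by gcongr)
    _ = ε := by ring

theorem norm_sq_le_symbol (ξ : Rn n) : ‖ξ‖ ^ 2 ≤ symbol ξ := by
  unfold symbol
  have : (1 : ℝ) ≤ (2 * Real.pi) ^ 2 := by nlinarith [Real.pi_gt_three]
  exact le_mul_of_one_le_left (by positivity) this

/-- On the Fourier side, frequencies beyond `R` contribute at most `ε / 2` by decay of the
multiplier. Inside radius `R` the transform is determined, up to a small error, by its values on a
finite net, which is a finite-rank datum. -/
theorem isCompactOperator_freeResolvent_mul {s : ℝ} (hs : 0 < s) :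
    IsCompactOperator (freeResolvent n s * ballProj n) := by
  refine isCompactOperator_of_norm_le fun ε hε => ?_
  -- `R ≥ 1` gives `R ≤ R²`, so outside radius `R` the multiplier is at most `1 / R ≤ ε / 2`.
  set R : ℝ := max 1 (2 / ε) with hR
  have hR1 : 1 ≤ R := le_max_left _ _
  have hR2 : 2 / ε ≤ R := le_max_right _ _
  set W : ℝ := ‖(indicatorConstLp 2 (measurableSet_closedBall (x := (0 : Rn n)) (ε := R))
    measure_closedBall_lt_top.ne (1 : ℝ) : Lp ℝ 2 (volume : Measure (Rn n)))‖ with hW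
  have hW0 : 0 ≤ W := norm_nonneg _
  set V := ‖ballVec n‖ with hV
  have hV0 : 0 ≤ V := norm_nonneg _
  -- The mesh that makes the low-frequency error at most `ε / 2`; the `+ 1` keeps the denominator
  -- positive.
  set δ : ℝ := ε / 2 / (s⁻¹ * (2 * Real.pi * V) * W + 1) with hδ
  have hδ0 : 0 < δ := by positivity
  have hδ1 : s⁻¹ * (2 * Real.pi * δ * V) * W ≤ ε / 2 := by
    have h1 : δ * (s⁻¹ * (2 * Real.pi * V) * W + 1) = ε / 2 :=
      div_mul_cancel₀ _ (by positivity)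
    nlinarith
  obtain ⟨t, -, htf, htc⟩ :=
    (isCompact_closedBall (0 : Rn n) R).finite_cover_balls hδ0
  have : Fintype t := htf.fintype
  refine ⟨t, inferInstance,
    ((s⁻¹ * W : ℝ) : ℂ) • ContinuousLinearMap.pi fun j : t => innerSL ℂ (ballChar (j : Rn n)),
    fun f => ?_⟩
  set M : ℝ := ‖(ContinuousLinearMap.pi fun j : t => innerSL ℂ (ballChar (j : Rn n))) f‖ with hM
  have hM0 : 0 ≤ M := norm_nonneg _
  have hLf : ‖(((s⁻¹ * W : ℝ) : ℂ) • ContinuousLinearMap.pi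
      fun j : t => innerSL ℂ (ballChar (j : Rn n))) f‖ = s⁻¹ * W * M := by
    rw [smul_apply, norm_smul, Complex.norm_real, Real.norm_eq_abs, abs_of_nonneg (by positivity)]
  rw [hLf]
  set g : L2 n := 𝓕 (ballProj n f) with hg
  have hgn : ‖g‖ ≤ ‖f‖ := by rw [hg, Lp.norm_fourier_eq]; exact norm_ballProj_le f
  set A : ℝ := s⁻¹ * (M + 2 * Real.pi * δ * V * ‖f‖) with hA
  have hA0 : 0 ≤ A := by positivity
  have hpt : ∀ ξ ∈ Metric.closedBall (0 : Rn n) R,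
      ‖⟪ballChar ξ, f⟫_ℂ‖ ≤ M + 2 * Real.pi * δ * V * ‖f‖ := by
    intro ξ hξ
    obtain ⟨j, hj, hξj⟩ := Set.mem_iUnion₂.1 (htc hξ)
    have h1 : ‖⟪ballChar j, f⟫_ℂ‖ ≤ M :=
      norm_le_pi_norm ((ContinuousLinearMap.pi
        fun j : t => innerSL ℂ (ballChar (j : Rn n))) f) ⟨j, hj⟩
    have h2 : ‖⟪ballChar ξ - ballChar j, f⟫_ℂ‖ ≤ 2 * Real.pi * δ * V * ‖f‖ := by
      refine (norm_inner_le_norm _ _).trans ?_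
      gcongr
      refine (norm_ballChar_sub_le _ _).trans ?_
      gcongr
      rw [← dist_eq_norm]
      exact (Metric.mem_ball.1 hξj).le
    have h3 : ⟪ballChar ξ, f⟫_ℂ = ⟪ballChar j, f⟫_ℂ + ⟪ballChar ξ - ballChar j, f⟫_ℂ := by
      rw [← inner_add_left, add_sub_cancel]
    rw [h3]
    exact (norm_add_le _ _).trans (add_le_add h1 h2)
  set k1 : Lp ℝ 2 (volume : Measure (Rn n)) := indicatorConstLp 2
    (measurableSet_closedBall (x := (0 : Rn n)) (ε := R)) measure_closedBall_lt_top.ne A with hk1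
  set k2 : Lp ℝ 2 (volume : Measure (Rn n)) := (Lp.memLp g).norm.toLp _ with hk2
  have hk1n : ‖k1‖ = A * W := by
    rw [hk1, hW, norm_indicatorConstLp (by norm_num) (by norm_num),
      norm_indicatorConstLp (by norm_num) (by norm_num), norm_one, one_mul, Real.norm_eq_abs,
      abs_of_nonneg hA0]
  have hk2n : ‖k2‖ ≤ ‖g‖ := by
    apply Lp.norm_le_norm_of_ae_le
    filter_upwards [(Lp.memLp g).norm.coeFn_toLp] with ξ hξ
    rw [hk2, hξ, norm_norm]
  have hmain : ‖(freeResolvent n s * ballProj n) f‖ ≤ ‖k1 + (ε / 2) • k2‖ := by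
    change ‖freeResolvent n s (ballProj n f)‖ ≤ _
    rw [freeResolvent_of_pos hs, ← Lp.norm_fourier_eq, fourier_fourierMul]
    apply Lp.norm_le_norm_of_ae_le
    filter_upwards [coeFn_mulCLM (memLp_resolventSymbol hs) g, coeFn_fourier_ballProj f,
      Lp.coeFn_add k1 ((ε / 2) • k2), Lp.coeFn_smul (ε / 2) k2,
      (Lp.memLp g).norm.coeFn_toLp, indicatorConstLp_coeFn (p := 2)
      (hs := measurableSet_closedBall (x := (0 : Rn n)) (ε := R))
      (hμs := measure_closedBall_lt_top.ne) (c := A)] with ξ h1 h2 h3 h4 h5 h6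
    rw [h1, h3, Pi.add_apply, h4, Pi.smul_apply, hk2, h5, hk1, h6, norm_mul, smul_eq_mul]
    refine le_trans ?_ (Real.le_norm_self _)
    by_cases hξ : ξ ∈ Metric.closedBall (0 : Rn n) R
    · rw [Set.indicator_of_mem hξ]
      have h7 : ‖g ξ‖ ≤ M + 2 * Real.pi * δ * V * ‖f‖ := by rw [h2]; exact hpt ξ hξ
      have h8 := norm_resolventSymbol_le hs ξ
      rw [one_div] at h8
      have h9 := mul_le_mul h8 h7 (norm_nonneg _) (by positivity)
      have : 0 ≤ ε / 2 * ‖g ξ‖ := by positivity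
      linarith
    · rw [Set.indicator_of_notMem hξ, zero_add]
      gcongr
      rw [Metric.mem_closedBall, dist_zero_right, not_le] at hξ
      have h7 : R ≤ symbol ξ + s := by
        have := norm_sq_le_symbol ξ
        nlinarith
      rw [Complex.norm_real, Real.norm_eq_abs, abs_of_nonneg (inv_nonneg.2 (by linarith))]
      have h8 : (symbol ξ + s)⁻¹ ≤ (2 / ε)⁻¹ := inv_anti₀ (by positivity) (hR2.trans h7)
      rwa [inv_div] at h8
  refine hmain.trans ((norm_add_le _ _).trans ?_)
  rw [norm_smul, Real.norm_eq_abs, abs_of_pos (half_pos hε), hk1n]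
  have h1 : ε / 2 * ‖k2‖ ≤ ε / 2 * ‖f‖ := by gcongr; exact hk2n.trans hgn
  have h2 := mul_le_mul_of_nonneg_right hδ1 (norm_nonneg f)
  rw [hA]
  linarith

/-! ### Uniform boundedness of the Birman–Schwinger operators -/

/-- By Plancherel, `‖y‖²` is the pairing of two Fourier transforms weighted by `(symbol + s)⁻¹`. For
`|ξ| < 1` both transforms are bounded pointwise and the weight is at most `|ξ|⁻²`; for `|ξ| ≥ 1` the
weight is at most `1` and Cauchy–Schwarz suffices. Neither bound depends on `s`. -/
theorem exists_norm_ballProj_mul_le (hn : 3 ≤ n) :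
    ∃ C : ℝ, ∀ s, 0 < s → ‖ballProj n * freeResolvent n s * ballProj n‖ ≤ C := by
  have hfin : Module.finrank ℝ (Rn n) = n := finrank_euclideanSpace_fin
  have : Nontrivial (Rn n) := by
    apply Module.nontrivial_of_finrank_pos (R := ℝ)
    omega
  -- Here the dimension matters: the exponent `2` has to be smaller than `n`.
  have hκ : IntegrableOn (fun ξ : Rn n => ‖ξ‖ ^ (-2 : ℝ)) (Metric.ball 0 1) volume := by
    refine integrableOn_ball_of_norm_le_rpow (α := 2) (C := 1) (by omega) ?_ ?_ ?_
    · rw [hfin]; exact_mod_cast hn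
    · refine Eventually.of_forall fun ξ => ?_
      rw [Real.norm_eq_abs, abs_of_nonneg (by positivity), one_mul]
    · exact (measurable_norm.pow_const _).aestronglyMeasurable
  set κ : Rn n → ℝ := (Metric.ball 0 1).indicator fun ξ => ‖ξ‖ ^ (-2 : ℝ) with hκdef
  have hκi : Integrable κ volume := hκ.integrable_indicator measurableSet_ball
  have hκ0 : ∀ ξ, 0 ≤ κ ξ := fun ξ => Set.indicator_nonneg (fun ξ _ => by positivity) ξ
  set V := ‖ballVec n‖ with hV
  have hV0 : 0 ≤ V := norm_nonneg _
  set I := ∫ ξ, κ ξ with hI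
  have hI0 : 0 ≤ I := integral_nonneg hκ0
  refine ⟨V ^ 2 * I + 1, fun s hs => ContinuousLinearMap.opNorm_le_bound _ (by positivity)
    fun f => ?_⟩
  set y := (ballProj n * freeResolvent n s * ballProj n) f with hy
  set a : L2 n := 𝓕 (ballProj n y) with ha
  set b : L2 n := 𝓕 (ballProj n f) with hb
  have han : ‖a‖ ≤ ‖y‖ := by rw [ha, Lp.norm_fourier_eq]; exact norm_ballProj_le y
  have hbn : ‖b‖ ≤ ‖f‖ := by rw [hb, Lp.norm_fourier_eq]; exact norm_ballProj_le f
  have hin : ⟪y, y⟫_ℂ = ⟪a, mulCLM _ (memLp_resolventSymbol hs) b⟫_ℂ := by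
    have h1 : ⟪y, y⟫_ℂ = ⟪y, ballProj n (freeResolvent n s (ballProj n f))⟫_ℂ := rfl
    rw [h1, ← inner_ballProj_left, freeResolvent_of_pos hs, inner_fourierMul_right]
  set a' : Lp ℝ 2 (volume : Measure (Rn n)) := (Lp.memLp a).norm.toLp _ with ha'
  set b' : Lp ℝ 2 (volume : Measure (Rn n)) := (Lp.memLp b).norm.toLp _ with hb'
  have ha'n : ‖a'‖ ≤ ‖a‖ := by
    apply Lp.norm_le_norm_of_ae_le
    filter_upwards [(Lp.memLp a).norm.coeFn_toLp] with ξ hξ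
    rw [ha', hξ, norm_norm]
  have hb'n : ‖b'‖ ≤ ‖b‖ := by
    apply Lp.norm_le_norm_of_ae_le
    filter_upwards [(Lp.memLp b).norm.coeFn_toLp] with ξ hξ
    rw [hb', hξ, norm_norm]
  have hab : Integrable (fun ξ => ⟪a' ξ, b' ξ⟫_ℝ) volume := L2.integrable_inner a' b'
  have hbound : ‖⟪y, y⟫_ℂ‖ ≤ ∫ ξ, (κ ξ * (V * ‖y‖ * (V * ‖f‖)) + ⟪a' ξ, b' ξ⟫_ℝ) := by
    rw [hin, L2.inner_def]
    refine norm_integral_le_of_norm_le ((hκi.mul_const _).add hab) ?_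
    have hne : ∀ᵐ ξ : Rn n, ξ ≠ 0 := compl_mem_ae_iff.2 (measure_singleton _)
    filter_upwards [coeFn_mulCLM (memLp_resolventSymbol hs) b, norm_fourier_ballProj_le y,
      norm_fourier_ballProj_le f, (Lp.memLp a).norm.coeFn_toLp, (Lp.memLp b).norm.coeFn_toLp,
      hne] with ξ h1 h2 h3 h4 h5 h6
    rw [h1, ha', hb', h4, h5]
    refine (norm_inner_le_norm _ _).trans ?_
    rw [norm_mul, Complex.norm_real, Real.norm_eq_abs,
      abs_of_nonneg (inv_nonneg.2 (by linarith [symbol_nonneg ξ]))]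
    simp only [RCLike.inner_apply, conj_trivial]
    have hpos : 0 < ‖ξ‖ := norm_pos_iff.2 h6
    have hsym := norm_sq_le_symbol ξ
    have hinv : (symbol ξ + s)⁻¹ ≤ (‖ξ‖ ^ 2)⁻¹ := inv_anti₀ (by positivity) (by linarith)
    have hinv0 : 0 ≤ (symbol ξ + s)⁻¹ := inv_nonneg.2 (by linarith [symbol_nonneg ξ])
    have hab0 : 0 ≤ ‖b ξ‖ * ‖a ξ‖ := by positivity
    by_cases hξ : ξ ∈ Metric.ball (0 : Rn n) 1
    · have hκξ : κ ξ = (‖ξ‖ ^ 2)⁻¹ := by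
        rw [hκdef, Set.indicator_of_mem hξ, Real.rpow_neg hpos.le, Real.rpow_two]
      have h7 : ‖a ξ‖ * ‖b ξ‖ ≤ V * ‖y‖ * (V * ‖f‖) :=
        mul_le_mul h2 h3 (norm_nonneg _) (by positivity)
      have h8 := mul_le_mul hinv h7 (by positivity) (by positivity)
      rw [hκξ]
      linarith
    · have h7 : 1 ≤ ‖ξ‖ := by
        rw [mem_ball_zero_iff, not_lt] at hξ; exact hξ
      have h8 : (symbol ξ + s)⁻¹ ≤ 1 := hinv.trans (inv_le_one_of_one_le₀ (by nlinarith))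
      have h9 : 0 ≤ κ ξ * (V * ‖y‖ * (V * ‖f‖)) := mul_nonneg (hκ0 ξ) (by positivity)
      nlinarith
  rw [integral_add (hκi.mul_const _) hab, integral_mul_const, ← L2.inner_def] at hbound
  have h1 : ⟪a', b'⟫_ℝ ≤ ‖y‖ * ‖f‖ :=
    (real_inner_le_norm _ _).trans (mul_le_mul (ha'n.trans han) (hb'n.trans hbn)
      (norm_nonneg _) (norm_nonneg _))
  have h2 : ‖⟪y, y⟫_ℂ‖ = ‖y‖ * ‖y‖ := by
    rw [inner_self_eq_norm_sq_to_K]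
    simp [sq]
  rw [h2] at hbound
  rcases (norm_nonneg y).eq_or_lt with h0 | h0
  · rw [← h0]; positivity
  · refine le_of_mul_le_mul_left ?_ h0
    nlinarith

/-! ### Approximate eigenfunctions -/

theorem exists_symbol_eq (hn : 0 < n) {E : ℝ} (hE : 0 ≤ E) : ∃ ξ : Rn n, symbol ξ = E := by
  refine ⟨EuclideanSpace.single ⟨0, hn⟩ (√E / (2 * Real.pi)), ?_⟩
  rw [symbol, PiLp.norm_single, Real.norm_eq_abs, sq_abs, div_pow, Real.sq_sqrt hE]
  field_simp

/-- The function is the inverse Fourier transform of the indicator `w` of a small ball around a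
frequency `ξ₀` with symbol `E`. Concentration in frequency spreads it out in space, so little of its
mass stays in the unit ball. -/
theorem exists_approx_eigenfunction (hn : 0 < n) {E : ℝ} (hE : 0 ≤ E) {δ : ℝ} (hδ : 0 < δ) :
    ∃ u : (negLaplacian n).domain, (u : L2 n) ≠ 0 ∧
      ‖negLaplacian n u - (E : ℂ) • (u : L2 n)‖ ≤ δ * ‖(u : L2 n)‖ ∧
      ‖ballProj n u‖ ≤ δ * ‖(u : L2 n)‖ := by
  obtain ⟨ξ₀, hξ₀⟩ := exists_symbol_eq hn hE
  have hfin : Module.finrank ℝ (Rn n) = n := finrank_euclideanSpace_fin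
  obtain ⟨r₁, hr₁, hsym⟩ := Metric.continuous_iff.1 (continuous_symbol (n := n)) ξ₀ δ hδ
  set V := ‖ballVec n‖ with hV
  set m := (volume : Measure (Rn n)).real (Metric.ball 0 1) with hm
  have hlim : Tendsto (fun r : ℝ => V * √(r ^ n * m)) (𝓝[>] 0) (𝓝 0) := by
    have : ContinuousAt (fun r : ℝ => V * √(r ^ n * m)) 0 := by fun_prop
    have h2 := this.tendsto.mono_left (nhdsWithin_le_nhds (s := Set.Ioi 0))
    simpa [zero_pow hn.ne'] using h2
  -- `r < r₁` controls the symbol to within `δ`, and `V ‖w‖ < δ²` controls the mass in the unit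
  -- ball.
  obtain ⟨r, ⟨hrδ, hr1⟩, hr0⟩ := ((hlim.eventually (gt_mem_nhds (pow_pos hδ 2))).and
    ((eventually_lt_nhds hr₁).filter_mono nhdsWithin_le_nhds)
    |>.and self_mem_nhdsWithin).exists
  have hr0 : 0 < r := hr0
  set A := Metric.ball ξ₀ r with hA
  have hAm : MeasurableSet A := measurableSet_ball
  have hAf : (volume : Measure (Rn n)) A ≠ ⊤ := measure_ball_lt_top.ne
  have hvol : (volume : Measure (Rn n)).real A = r ^ n * m := by
    rw [hA, Measure.real, Measure.addHaar_ball_of_pos _ _ hr0, hfin, ENNReal.toReal_mul,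
      ENNReal.toReal_ofReal (by positivity)]; rfl
  have hAsym : ∀ ξ ∈ A, |symbol ξ - E| ≤ δ := by
    intro ξ hξ
    have := hsym ξ ((Metric.mem_ball.1 hξ).trans hr1)
    rw [hξ₀, Real.dist_eq] at this
    exact this.le
  set w : L2 n := indicatorConstLp 2 hAm hAf (1 : ℂ) with hw
  have hwae : w =ᵐ[volume] A.indicator fun _ => (1 : ℂ) := indicatorConstLp_coeFn
  have hwn : ‖w‖ = √(r ^ n * m) := by
    rw [hw, norm_indicatorConstLp (by norm_num) (by norm_num), norm_one, one_mul, hvol,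
      Real.sqrt_eq_rpow]
    norm_num
  have hvmem : MemLp (fun ξ => (symbol ξ : ℂ) * w ξ) 2 volume := by
    refine (Lp.memLp w).of_le_mul (c := E + δ) ?_ ?_
    · exact (Complex.continuous_ofReal.comp continuous_symbol).aestronglyMeasurable.mul
        (Lp.aestronglyMeasurable w)
    · filter_upwards [hwae] with ξ hξ
      rw [hξ]
      by_cases h : ξ ∈ A
      · rw [Set.indicator_of_mem h, mul_one, norm_one, mul_one, Complex.norm_real,
          Real.norm_eq_abs, abs_of_nonneg (symbol_nonneg ξ)]
        linarith [(abs_le.1 (hAsym ξ h)).2]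
      · simp [h]
  set v : L2 n := hvmem.toLp _ with hv
  have hvae : v =ᵐ[volume] fun ξ => (symbol ξ : ℂ) * w ξ := hvmem.coeFn_toLp
  have hmem := fourierInv_mem_sobolevH2 hvae
  have hun : ‖(𝓕⁻ w : L2 n)‖ = ‖w‖ := by
    rw [← Lp.norm_fourier_eq, fourier_fourierInv_eq]
  have hwpos : 0 < ‖w‖ := by
    rw [hwn]
    have : 0 < m := ENNReal.toReal_pos (Metric.measure_ball_pos _ _ one_pos).ne'
      measure_ball_lt_top.ne
    positivity
  refine ⟨⟨(𝓕⁻ w : L2 n), hmem⟩, ?_, ?_, ?_⟩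
  · rw [← norm_pos_iff]
    change 0 < ‖(𝓕⁻ w : L2 n)‖
    rwa [hun]
  · rw [negLaplacian_fourierInv hvae]
    change ‖(𝓕⁻ v : L2 n) - (E : ℂ) • (𝓕⁻ w : L2 n)‖ ≤ δ * ‖(𝓕⁻ w : L2 n)‖
    have hsub : (𝓕⁻ v : L2 n) - (E : ℂ) • (𝓕⁻ w : L2 n) = (𝓕⁻ (v - (E : ℂ) • w) : L2 n) := by
      rw [sub_eq_iff_eq_add, ← FourierTransform.fourierInv_smul, ← FourierTransform.fourierInv_add,
        sub_add_cancel]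
    rw [hun, hsub, ← Lp.norm_fourier_eq, fourier_fourierInv_eq]
    apply Lp.norm_le_mul_norm_of_ae_le_mul
    filter_upwards [hvae, hwae, Lp.coeFn_sub v ((E : ℂ) • w), Lp.coeFn_smul (E : ℂ) w]
      with ξ h1 h2 h3 h4
    rw [h3, Pi.sub_apply, h4, Pi.smul_apply, h1, smul_eq_mul, ← sub_mul, norm_mul]
    by_cases h : ξ ∈ A
    · gcongr
      rw [← Complex.ofReal_sub, Complex.norm_real]
      exact hAsym ξ h
    · rw [h2]; simp [h]
  · set u : L2 n := 𝓕⁻ w with hu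
    change ‖ballProj n u‖ ≤ δ * ‖u‖
    -- Pairing `w` with the transform of `P u`, bounded by `V ‖u‖`, gives `‖P u‖² ≤ V ‖u‖ · vol A`.
    -- As `vol A = ‖u‖²` and `V ‖u‖ ≤ δ²`, the claim follows.
    have h1 : ‖⟪ballProj n u, ballProj n u⟫_ℂ‖ ≤ V * ‖u‖ * (r ^ n * m) := by
      have h2 : ⟪ballProj n u, ballProj n u⟫_ℂ = ⟪w, (𝓕 (ballProj n u) : L2 n)⟫_ℂ := by
        rw [inner_ballProj_left, ballProj_ballProj, ← Lp.inner_fourier_eq, hu,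
          fourier_fourierInv_eq]
      rw [h2, hw, L2.inner_indicatorConstLp_one, ← hvol]
      exact norm_setIntegral_le_of_norm_le_const_ae hAf.lt_top
        (ae_restrict_of_ae (norm_fourier_ballProj_le u))
    have h3 : ‖⟪ballProj n u, ballProj n u⟫_ℂ‖ = ‖ballProj n u‖ ^ 2 := by
      rw [inner_self_eq_norm_sq_to_K]
      simp
    have h4 : r ^ n * m = ‖u‖ ^ 2 := by
      rw [hun, hwn, Real.sq_sqrt (by positivity)]
    have h5 : V * ‖u‖ ≤ δ ^ 2 := by rw [hun, hwn]; exact hrδ.le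
    rw [h3, h4] at h1
    refine le_of_sq_le_sq ?_ (by positivity)
    rw [mul_pow]
    exact h1.trans (by gcongr)

end

end Schroedinger

/-! ### The spherical well -/

theorem corollaryC3 (n : ℕ) (hn : 3 ≤ n) :
    ∃ lc : ℝ, 0 < lc ∧
      (∀ l : ℝ, l < lc →
        Schroedinger.discreteSpectrum (Schroedinger.schrodinger (Schroedinger.well n l)) = ∅) ∧
      (∀ l : ℝ, lc < l →
        (Schroedinger.discreteSpectrum
          (Schroedinger.schrodinger (Schroedinger.well n l))).Nonempty) ∧
      Schroedinger.HasVirtualLevelAtZero (Schroedinger.well n lc) := by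
  open Schroedinger in
  have hpos : 0 < n := by omega
  obtain ⟨C, hC⟩ := exists_norm_ballProj_mul_le hn
  obtain ⟨lc, hlc, hlt, hgt, hnn⟩ := (isResolventFamily n).exists_critical_coupling
    isSelfAdjoint_ballProj (ContinuousLinearMap.ext ballProj_ballProj) ballProj_ne_zero
    (fun s hs => isCompactOperator_freeResolvent_mul hs) hC
    (fun E hE δ hδ => exists_approx_eigenfunction hpos hE hδ)
  refine ⟨lc, hlc, fun l hl => ?_, fun l hl => ?_, ?_, fun ε hε => ?_⟩
  · rw [schrodinger_well]; exact hlt l hl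
  · rw [schrodinger_well]
    obtain ⟨E, -, hE⟩ := hgt l hl
    exact ⟨E, hE⟩
  · rw [schrodinger_well]; exact hnn
  · have hwell : (fun x => (1 + ε) * well n lc x) = well n ((1 + ε) * lc) := by
      ext x
      simp only [well]
      ring
    rw [hwell, schrodinger_well]
    obtain ⟨E, hE0, hE⟩ := hgt ((1 + ε) * lc) (by nlinarith)
    refine lt_of_le_of_lt (sInf_le ⟨E, hE.1, rfl⟩ : infSpectrum _ ≤ (E : EReal)) ?_
    exact_mod_cast hE0
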